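/- Let $M$ be a lattice of rank $n$ in an $n$-dimensional real vector space $M_{\mathbb R}$, let $N=\mathrm{Hom}_{\mathbb Z}(M,\mathbb Z)\subset M_{\mathbb R}^*$ be the dual lattice, and let $T_N=\mathrm{Hom}(M,\mathbb C^\times)$; for $t\in T_N$ and $m\in M$ write $m(t)=t(m)$. Let $\Box\subset M_{\mathbb R}$ be an $n$-dimensional convex polytope (a bounded intersection of finitely many affine half-spaces) whose set $\mathrm{ext}\,\Box$ of extreme points is contained in $M$, and which is simple: for every $\alpha\in\mathrm{ext}\,\Box$ the tangent cone $C_\alpha=\mathbb R_{\ge0}(\Box-\alpha)$ is generated by linearly independent vectors. For $\alpha\in\mathrm{ext}\,\Box$ let $\sigma_\alpha\subset M_{\mathbb R}^*$ be the cone dual to $C_\alpha$, let $N'_\alpha\subset N$ be the subgroup generated by the primitive generators of $\sigma_\alpha$ in $N$ (the shortest nonzero elements of $N$ on its extreme rays), let $M'_\alpha=\{v\in M_{\mathbb R}:\langle f,v\rangle\in\mathbb Z\ \text{for all } f\in N'_\alpha\}\supset M$, and let $K_\alpha=N/N'_\alpha$. For $k\in K_\alpha$ and $\lambda\in M'_\alpha$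 put $e_k(\lambda)=\exp(2\pi i\langle k,\lambda\rangle)$, where $\langle k,\lambda\rangle\in\mathbb R/\mathbb Z$ is computed from any representative of $k$ in $N$. Then $K_\alpha$ is finite, and the cone $C_\alpha$ has exactly $n$ primitive generators $\lambda'^1_\alpha,\dots,\lambda'^n_\alpha$ in $M'_\alpha$ (the edge vectors of $\Box$ at $\alpha$ in $M'_\alpha$). For $t\in T_N$ put $$\nu_\alpha(t)=\frac1{|K_\alpha|}\sum_{k\in K_\alpha}\frac{\alpha(t)}{\bigl(1-e_k(\lambda'^1_\alpha)\lambda'^1_\alpha(t)\bigr)\cdots\bigl(1-e_k(\lambda'^n_\alpha)\lambda'^n_\alpha(t)\bigr)},$$ where $\lambda(t)$, for $\lambda\in M'_\alpha$, means $t'(\lambda)$ for a homomorphism $t':M'_\alpha\to\mathbb C^\times$ extending $t$; such an extension exists, and $\nu_\alpha(t)$ does not depend on its choice. Then $$\sum_{m\in\Box\cap M}m(t)=\sum_{\alpha\in\mathrm{ext}\,\Box}\nu_\alpha(t)$$ for every $t\in T_N$ at which none of the denominators on the right-hand side vanishes. -/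

import Mathlib

open Module

noncomputable section

namespace LatticePolytope

section Pairing

variable {W U : Type*} [AddCommGroup W] [Module ℝ W] [AddCommGroup U] [Module ℝ U]

/-- The dual, with respect to a real pairing `p`, of an additive subgroup `L`: all `u` that pair
integrally with every element of `L`. -/
def dualLattice (p : W →ₗ[ℝ] U →ₗ[ℝ] ℝ) (L : Submodule ℤ W) : Submodule ℤ U where
  carrier := {u | ∀ w ∈ L, ∃ z : ℤ, p w u = z}
  zero_mem' := fun w _ => ⟨0, by simp⟩
  add_mem' := by
    intro a b ha hb w hw
    obtain ⟨x, hx⟩ := ha w hw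
    obtain ⟨y, hy⟩ := hb w hw
    exact ⟨x + y, by simp [hx, hy]⟩
  smul_mem' := by
    intro c a ha w hw
    obtain ⟨x, hx⟩ := ha w hw
    exact ⟨c * x, by simp [hx]⟩

/-- The closed ray spanned by `u`. -/
def ray (u : W) : Set W := {x | ∃ r : ℝ, 0 ≤ r ∧ x = r • u}

/-- The primitive generators of a (strongly convex) cone `C` in the lattice `L`: the shortest
nonzero elements of `L` on the extreme rays of `C`. -/
def primitiveGenerators (L : Submodule ℤ W) (C : Set W) : Set W :=
  {u | u ∈ L ∧ u ≠ 0 ∧ IsExtreme ℝ C (ray u) ∧ ∀ r : ℝ, 0 < r → r < 1 → r • u ∉ L}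

end Pairing

variable {V : Type*} [NormedAddCommGroup V] [NormedSpace ℝ V]

/-- A convex polytope: a bounded intersection of finitely many affine half-spaces. -/
def IsConvexPolytope (P : Set V) : Prop :=
  Bornology.IsBounded P ∧
    ∃ H : Finset (Dual ℝ V × ℝ), P = {v | ∀ h ∈ H, h.1 v ≤ h.2}

/-- The tangent cone `C_α = ℝ_{≥0} (P - α)`. -/
def tangentCone (P : Set V) (α : V) : Set V :=
  {w | ∃ r : ℝ, 0 ≤ r ∧ ∃ v ∈ P, w = r • (v - α)}

/-- `P` is simple at `α`: the tangent cone is generated by linearly independent vectors. -/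
def IsSimpleAt (P : Set V) (α : V) : Prop :=
  ∃ C : PointedCone ℝ V, C.IsSimplicial ∧ (C : Set V) = tangentCone P α

/-- A full-dimensional simple convex polytope whose extreme points lie in the lattice `M`. -/
structure IsSimpleLatticePolytope (M : Submodule ℤ V) (P : Set V) : Prop where
  polytope : IsConvexPolytope P
  full_dim : affineSpan ℝ P = ⊤
  integral : P.extremePoints ℝ ⊆ M
  simple : ∀ α ∈ P.extremePoints ℝ, IsSimpleAt P α

/-- The lattice `N = Hom(M, ℤ)`, inside `Hom(V, ℝ)`. -/
def latticeN (M : Submodule ℤ V) : Submodule ℤ (Dual ℝ V) :=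
  dualLattice (Dual.eval ℝ V) M

/-- The cone `σ_α` dual to the tangent cone `C_α`. -/
def dualCone (P : Set V) (α : V) : PointedCone ℝ (Dual ℝ V) :=
  PointedCone.dual (Dual.eval ℝ V) (tangentCone P α)

/-- The dual edge lattice `N'_α`, generated by the primitive generators of `σ_α` in `N`. -/
def dualEdgeLattice (M : Submodule ℤ V) (P : Set V) (α : V) : Submodule ℤ (Dual ℝ V) :=
  Submodule.span ℤ (primitiveGenerators (latticeN M) (dualCone P α : Set (Dual ℝ V)))

/-- The superlattice `M'_α` of `M`, the dual of `N'_α`. -/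
def superLattice (M : Submodule ℤ V) (P : Set V) (α : V) : Submodule ℤ V :=
  dualLattice (LinearMap.id : Dual ℝ V →ₗ[ℝ] Dual ℝ V) (dualEdgeLattice M P α)

/-- The group `K_α = N / N'_α`. -/
abbrev groupK (M : Submodule ℤ V) (P : Set V) (α : V) : Type _ :=
  latticeN M ⧸ (dualEdgeLattice M P α).submoduleOf (latticeN M)

/-- The edge vectors of `P` at `α` in the lattice `M'_α`. -/
def edgeVectors (M : Submodule ℤ V) (P : Set V) (α : V) : Set (superLattice M P α) :=
  {l | (l : V) ∈ primitiveGenerators (superLattice M P α) (tangentCone P α)}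

/-- `e_k(l) = exp(2πi ⟨k, l⟩)` for `k ∈ K_α` and `l ∈ M'_α`, where `⟨k, l⟩ ∈ ℝ/ℤ` is computed
from any representative of `k` in `N`. -/
def eK (M : Submodule ℤ V) (P : Set V) (α : V) (k : groupK M P α) (l : superLattice M P α) : ℂ :=
  Quotient.liftOn' k
    (fun n : latticeN M =>
      Complex.exp (2 * Real.pi * Complex.I * (((n : Dual ℝ V) (l : V) : ℝ) : ℂ)))
    (by
      intro a b hab
      have hab' : ((a : Dual ℝ V) - b) ∈ dualEdgeLattice M P α := by
        rw [Submodule.quotientRel_def] at hab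
        exact hab
      obtain ⟨z, hz⟩ := l.2 _ hab'
      have hz' : (a : Dual ℝ V) (l : V) = (b : Dual ℝ V) (l : V) + z := by
        have h : (a : Dual ℝ V) (l : V) - (b : Dual ℝ V) (l : V) = z := hz
        linarith
      refine Complex.exp_eq_exp_iff_exists_int.2 ⟨z, ?_⟩
      rw [hz']
      push_cast
      ring)

theorem dualEdgeLattice_le (M : Submodule ℤ V) (P : Set V) (α : V) :
    dualEdgeLattice M P α ≤ latticeN M :=
  Submodule.span_le.2 fun _ hu => hu.1

theorem le_superLattice (M : Submodule ℤ V) (P : Set V) (α : V) : M ≤ superLattice M P α :=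
  fun m hm _ hf => dualEdgeLattice_le M P α hf m hm

/-- A point of the torus `T_N = Hom(M, ℂˣ)` is an additive character of `M`, and `m(t)` is `t m`.
The point `t'` of `Hom(M'_α, ℂˣ)` lies over `t` if its restriction to `M` is `t`. -/
def LiesOver (M : Submodule ℤ V) (P : Set V) (α : V)
    (t' : AddChar (superLattice M P α) ℂ) (t : AddChar M ℂ) : Prop :=
  ∀ m : M, t' (Submodule.inclusion (le_superLattice M P α) m) = t m

/-- The extreme points of `P`, as elements of `M`. -/
def vertices (M : Submodule ℤ V) (P : Set V) : Set M :=
  {α | (α : V) ∈ P.extremePoints ℝ}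

/-- `ν_α(t)`, where `l(t)` for `l ∈ M'_α` is evaluated at a point `t'` over `t`. -/
def nu (M : Submodule ℤ V) (P : Set V) (α : M) (t : AddChar M ℂ)
    (t' : AddChar (superLattice M P α) ℂ) : ℂ :=
  (1 / (Nat.card (groupK M P α) : ℂ)) *
    ∑ᶠ k : groupK M P α, t α / ∏ᶠ l ∈ edgeVectors M P α, (1 - eK M P α k l * t' l)

/-- No denominator in `ν_α(t)` vanishes. -/
def IsRegularAt (M : Submodule ℤ V) (P : Set V) (α : M)
    (t' : AddChar (superLattice M P α) ℂ) : Prop :=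
  ∀ k : groupK M P α, ∀ l ∈ edgeVectors M P α, 1 - eK M P α k l * t' l ≠ 0

end LatticePolytope

end

/-! The formula compares two evaluations of one formal sum: that of the indicator function of the
lattice points of the polytope.

A function on `V`, possibly of infinite support, is summed against a character `T` by convolving it
with some `q` in the group algebra so that a finitely supported `p` results; its sum is `p(T) /
q(T)`, provided `q(T) ≠ 0`. This value is unique and additive (`HasFormalSum.unique`,
`HasFormalSum.sum`), needs no convergence, and vanishes for suitable cones containing a line
(`hasFormalSum_zero_of_mem`).

The Brianchon–Gram formula (`gramSum_eq_indicator`) writes the indicator of the polytope as the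
alternating sum, over its faces, of the indicators of the tangent cones along them. All faces of
positive dimension give cones with lines, so only the vertices contribute.

At a vertex the edge vectors form a basis of `M'_α`, so the lattice points of the cone in `M'_α` sum
to a product of geometric series (`hasFormalSum_cone`). Orthogonality of the characters of `K_α`
(`sum_eK`) cuts `M'_α` down to `M`: the indicator of `M` is the average of the `e_k`. The averaged
product is `ν_α` (`hasFormalSum_faceCone`). -/

noncomputable section

namespace LatticePolytope

/-! ### Formal sums of functions against a character -/

section FormalSum

variable {V : Type*} [AddCommGroup V]

/-- The action of the group algebra `ℂ[V]` on functions `V → ℂ` by convolution. -/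
def convolution (V : Type*) [AddCommGroup V] : AddMonoidAlgebra ℂ V →ₐ[ℂ] Module.End ℂ (V → ℂ) :=
  AddMonoidAlgebra.lift ℂ _ V
    { toFun := fun v => LinearMap.funLeft ℂ ℂ fun x => x - v.toAdd
      map_one' := by ext f x; simp [LinearMap.funLeft]
      map_mul' := by
        intro v w
        ext f x
        simp [LinearMap.funLeft, sub_sub] }

theorem convolution_single (v : V) (c : ℂ) (f : V → ℂ) (x : V) :
    convolution V (AddMonoidAlgebra.single v c) f x = c * f (x - v) := by
  simp [convolution, LinearMap.funLeft]

theorem convolution_coeff (q p : AddMonoidAlgebra ℂ V) :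
    convolution V q ⇑p.coeff = ⇑(q * p).coeff := by
  induction q using AddMonoidAlgebra.induction_linear with
  | zero => simp
  | add f g hf hg => simp [add_mul, hf, hg]
  | single v c =>
    ext x
    rw [convolution_single]
    rw [AddMonoidAlgebra.coeff_single_mul_apply, sub_eq_neg_add]

/-- Evaluation of an element of `ℂ[V]` at a character of `V`. -/
def evalChar (T : AddChar V ℂ) : AddMonoidAlgebra ℂ V →ₐ[ℂ] ℂ :=
  AddMonoidAlgebra.lift ℂ _ V T.toMonoidHom

theorem evalChar_single (T : AddChar V ℂ) (v : V) (c : ℂ) :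
    evalChar T (AddMonoidAlgebra.single v c) = c * T v := by
  simp [evalChar]

/-- `f : V → ℂ` has formal sum `s` at `T` if `q * f = p` for some `p, q ∈ ℂ[V]` such that
`q(T) ≠ 0` and `s = p(T) / q(T)`. -/
def HasFormalSum (T : AddChar V ℂ) (f : V → ℂ) (s : ℂ) : Prop :=
  ∃ q p : AddMonoidAlgebra ℂ V,
    evalChar T q ≠ 0 ∧ convolution V q f = ⇑p.coeff ∧ evalChar T p = s * evalChar T q

variable {T : AddChar V ℂ} {f g : V → ℂ} {s s' : ℂ}

/-- Convolving `f` with `q * q'` in either order gives `q * p' = q' * p` in the group algebra;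
evaluate at `T` and cancel the nonzero values of `q` and `q'`. -/
theorem HasFormalSum.unique (h : HasFormalSum T f s) (h' : HasFormalSum T f s') : s = s' := by
  obtain ⟨q, p, hq, hf, hp⟩ := h
  obtain ⟨q', p', hq', hf', hp'⟩ := h'
  have h1 : ⇑(q * p').coeff = ⇑(q' * p).coeff := by
    rw [← convolution_coeff, ← convolution_coeff, ← hf, ← hf', ← Module.End.mul_apply,
      ← Module.End.mul_apply, ← map_mul, ← map_mul, mul_comm]
  have h2 : q * p' = q' * p := by
    ext x
    exact congrFun h1 x
  have h3 := congrArg (evalChar T) h2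
  rw [map_mul, map_mul, hp, hp'] at h3
  apply mul_right_cancel₀ (mul_ne_zero hq hq')
  linear_combination -h3

theorem HasFormalSum.add (h : HasFormalSum T f s) (h' : HasFormalSum T g s') :
    HasFormalSum T (f + g) (s + s') := by
  obtain ⟨q, p, hq, hf, hp⟩ := h
  obtain ⟨q', p', hq', hf', hp'⟩ := h'
  refine ⟨q * q', q' * p + q * p', by simp [hq, hq'], ?_, ?_⟩
  · rw [map_add, map_mul, Module.End.mul_apply, Module.End.mul_apply, hf', convolution_coeff,
      ← Module.End.mul_apply, ← map_mul, mul_comm q q', map_mul, Module.End.mul_apply, hf,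
      convolution_coeff]
    simp
  · simp only [map_add, map_mul, hp, hp']
    ring

theorem HasFormalSum.const_mul (h : HasFormalSum T f s) (c : ℂ) :
    HasFormalSum T (fun x => c * f x) (c * s) := by
  obtain ⟨q, p, hq, hf, hp⟩ := h
  refine ⟨q, c • p, hq, ?_, ?_⟩
  · have : (fun x => c * f x) = c • f := rfl
    rw [this, map_smul, hf]
    simp
  · rw [map_smul, hp, smul_eq_mul, mul_assoc]

theorem HasFormalSum.zero : HasFormalSum T 0 0 := ⟨1, 0, by simp, by simp, by simp⟩

theorem HasFormalSum.sum {ι : Type*} {I : Finset ι} {f : ι → V → ℂ} {s : ι → ℂ}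
    (h : ∀ i ∈ I, HasFormalSum T (f i) (s i)) :
    HasFormalSum T (fun x => ∑ i ∈ I, f i x) (∑ i ∈ I, s i) := by
  classical
  induction I using Finset.induction_on with
  | empty => exact HasFormalSum.zero
  | insert a I ha ih =>
    simp only [Finset.sum_insert ha]
    exact (h a (Finset.mem_insert_self _ _)).add
      (ih fun i hi => h i (Finset.mem_insert_of_mem hi))

theorem HasFormalSum.translate (h : HasFormalSum T f s) (a : V) :
    HasFormalSum T (fun x => f (x - a)) (T a * s) := by
  obtain ⟨q, p, hq, hf, hp⟩ := h
  refine ⟨q, AddMonoidAlgebra.single a 1 * p, hq, ?_, ?_⟩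
  · have : (fun x => f (x - a)) = convolution V (AddMonoidAlgebra.single a 1) f := by
      ext x
      rw [convolution_single, one_mul]
    rw [this, ← Module.End.mul_apply, ← map_mul, mul_comm, map_mul, Module.End.mul_apply, hf,
      convolution_coeff]
  · rw [map_mul, evalChar_single, hp]
    ring

/-- A function whose difference with a weighted translate has a formal sum has one itself. -/
theorem HasFormalSum.of_sub_translate {v : V} {c : ℂ} (hc : 1 - c * T v ≠ 0)
    (h : HasFormalSum T (fun x => f x - c * f (x - v)) s) :
    HasFormalSum T f (s / (1 - c * T v)) := by
  obtain ⟨q, p, hq, hf, hp⟩ := h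
  have hev : evalChar T (1 - AddMonoidAlgebra.single v c) = 1 - c * T v := by
    rw [map_sub, map_one, evalChar_single]
  refine ⟨q * (1 - AddMonoidAlgebra.single v c), p, ?_, ?_, ?_⟩
  · rw [map_mul, hev]
    exact mul_ne_zero hq hc
  · rw [map_mul, Module.End.mul_apply, ← hf]
    congr 1
    ext x
    rw [map_sub, map_one, LinearMap.sub_apply, Pi.sub_apply, convolution_single,
      Module.End.one_apply]
  · rw [map_mul, hev, hp]
    field_simp

/-- A finitely supported function has its sum as formal sum. -/
theorem HasFormalSum.of_finset {A : Finset V} (hf : ∀ x ∉ A, f x = 0) :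
    HasFormalSum T f (∑ x ∈ A, f x * T x) := by
  refine ⟨1, ∑ x ∈ A, AddMonoidAlgebra.single x (f x), by simp, ?_, ?_⟩
  · classical
    ext x
    simp only [map_one, Module.End.one_apply]
    by_cases hx : x ∈ A
    · simp [Finsupp.single_apply, hx]
    · simp [Finsupp.single_apply, hx, hf x hx]
  · simp [map_sum, evalChar_single]

end FormalSum

/-! ### Faces of a simple polytope and the Brianchon–Gram formula -/

section BrianchonGram

variable {V : Type*} [NormedAddCommGroup V] [NormedSpace ℝ V] {ι : Type*}
  {P : Set V} {α β : V} {b c : Basis ι ℝ V} {S S' : Finset ι}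

/-- `α` is a vertex of `P` whose tangent cone is generated by the basis `b`. -/
structure IsVertexBasis (P : Set V) (α : V) (b : Basis ι ℝ V) : Prop where
  mem_extremePoints : α ∈ P.extremePoints ℝ
  tangentCone_eq : tangentCone P α = {w | ∀ j, 0 ≤ b.coord j w}

/-- The face of `P` through `α` in the directions `b j`, `j ∈ S`. -/
def face (P : Set V) (α : V) (b : Basis ι ℝ V) (S : Finset ι) : Set V :=
  {x ∈ P | ∀ j ∉ S, b.coord j (x - α) = 0}

/-- The tangent cone of `P` along a subset `F`, with apex at `F`. -/
def faceCone (P F : Set V) : Set V :=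
  {x | ∃ a ∈ F, ∃ w ∈ tangentCone P a, ∃ d ∈ vectorSpan ℝ F, x = a + w + d}

theorem apply_eq_sum_coord [Fintype ι] (b : Basis ι ℝ V) (ξ : Dual ℝ V) (w : V) :
    ξ w = ∑ j, b.coord j w * ξ (b j) := by
  conv_lhs => rw [← b.sum_repr w, map_sum]
  simp

theorem coord_eq_zero_of_mem_span {d : V} (hd : d ∈ Submodule.span ℝ (b '' S)) {j : ι}
    (hj : j ∉ S) : b.coord j d = 0 := by
  have : Submodule.span ℝ (b '' S) ≤ LinearMap.ker (b.coord j) := by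
    rw [Submodule.span_le]
    rintro _ ⟨i, hi, rfl⟩
    have : i ≠ j := fun h => hj (h ▸ hi)
    simp [this]
  exact this hd

namespace IsVertexBasis

theorem mem (h : IsVertexBasis P α b) : α ∈ P := h.mem_extremePoints.1

theorem coord_nonneg (h : IsVertexBasis P α b) {x : V} (hx : x ∈ P) (j : ι) :
    0 ≤ b.coord j (x - α) := by
  have : x - α ∈ tangentCone P α := ⟨1, zero_le_one, x, hx, by simp⟩
  rw [h.tangentCone_eq] at this
  exact this j

theorem exists_edge (h : IsVertexBasis P α b) (j : ι) : ∃ ε : ℝ, 0 < ε ∧ α + ε • b j ∈ P := by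
  classical
  have : b j ∈ tangentCone P α := by
    rw [h.tangentCone_eq]
    intro i
    by_cases hij : j = i <;> simp [hij]
  obtain ⟨r, hr, v, hv, hvj⟩ := this
  have hr0 : r ≠ 0 := by
    rintro rfl
    exact b.ne_zero j (by simpa using hvj)
  refine ⟨r⁻¹, by positivity, ?_⟩
  rw [hvj, smul_smul, inv_mul_cancel₀ hr0]
  simpa using hv

theorem mem_face (h : IsVertexBasis P α b) : α ∈ face P α b S :=
  ⟨h.mem, by simp⟩

theorem edge_mem_face_iff {ε : ℝ} (hε : 0 < ε) {j : ι} (hj : α + ε • b j ∈ P) :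
    α + ε • b j ∈ face P α b S ↔ j ∈ S := by
  classical
  refine ⟨fun hm => ?_, fun hm => ⟨hj, fun i hi => ?_⟩⟩
  · by_contra hjS
    have := hm.2 j hjS
    simp at this
    exact hε.ne' this
  · have : j ≠ i := fun h => hi (h ▸ hm)
    simp [this]

/-- The set `S` is recovered from the face: it holds exactly those `j` for which a short step along
`b j` stays in the face. -/
theorem face_injective (h : IsVertexBasis P α b) (hS : face P α b S = face P α b S') :
    S = S' := by
  ext j
  obtain ⟨ε, hε, hj⟩ := h.exists_edge j
  rw [← edge_mem_face_iff hε hj, hS, edge_mem_face_iff hε hj]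

theorem vectorSpan_face [Fintype ι] (h : IsVertexBasis P α b) :
    vectorSpan ℝ (face P α b S) = Submodule.span ℝ (b '' S) := by
  classical
  apply le_antisymm
  · rw [vectorSpan_eq_span_vsub_set_right ℝ h.mem_face, Submodule.span_le]
    rintro _ ⟨x, hx, rfl⟩
    simp only [vsub_eq_sub]
    rw [← b.sum_repr (x - α)]
    refine Submodule.sum_mem _ fun j _ => ?_
    by_cases hj : j ∈ S
    · exact Submodule.smul_mem _ _ (Submodule.subset_span ⟨j, hj, rfl⟩)
    · have := hx.2 j hj
      rw [Basis.coord_apply] at this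
      rw [this, zero_smul]
      exact Submodule.zero_mem _
  · rw [Submodule.span_le]
    rintro _ ⟨j, hj, rfl⟩
    obtain ⟨ε, hε, hm⟩ := h.exists_edge j
    have h1 := vsub_mem_vectorSpan ℝ ((edge_mem_face_iff (S := S) hε hm).2 hj) h.mem_face
    have h2 := Submodule.smul_mem _ ε⁻¹ h1
    simpa [smul_smul, inv_mul_cancel₀ hε.ne'] using h2

theorem finrank_vectorSpan_face [Fintype ι] (h : IsVertexBasis P α b) :
    finrank ℝ (vectorSpan ℝ (face P α b S)) = S.card := by
  classical
  rw [h.vectorSpan_face, ← Finset.coe_image, finrank_span_finset_eq_card,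
    Finset.card_image_of_injective _ b.injective]
  rw [Finset.coe_image]
  exact b.linearIndependent.linearIndepOn_id.mono (Set.image_subset_range _ _)

/-- Turns the inequalities at one vertex into a cone that depends on the face only. Together with
`finrank_vectorSpan_face` this makes each term of the Gram sum independent of the vertex at which
the face is listed. -/
theorem mem_faceCone_iff [Fintype ι] (h : IsVertexBasis P α b) {x : V} :
    x ∈ faceCone P (face P α b S) ↔ ∀ j ∉ S, 0 ≤ b.coord j (x - α) := by
  classical
  constructor
  · rintro ⟨a, ha, w, ⟨r, hr, v, hv, rfl⟩, d, hd, rfl⟩ j hj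
    rw [h.vectorSpan_face] at hd
    have h1 := coord_eq_zero_of_mem_span hd hj
    have h2 := ha.2 j hj
    have h3 := h.coord_nonneg hv j
    have h4 : a + r • (v - a) + d - α = (a - α) + r • ((v - α) - (a - α)) + d := by
      rw [sub_sub_sub_cancel_right]
      abel
    rw [h4, map_add, map_add, map_smul, map_sub _ (v - α), h1, h2, smul_eq_mul]
    simpa using mul_nonneg hr h3
  · intro hx
    refine ⟨α, h.mem_face, ∑ j ∈ Sᶜ, b.coord j (x - α) • b j, ?_,
      ∑ j ∈ S, b.coord j (x - α) • b j, ?_, ?_⟩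
    · rw [h.tangentCone_eq]
      intro i
      rw [map_sum]
      refine Finset.sum_nonneg fun j hj => ?_
      rw [map_smul, smul_eq_mul]
      refine mul_nonneg (hx j (by simpa using hj)) ?_
      by_cases hij : j = i <;> simp [hij]
    · rw [h.vectorSpan_face]
      exact Submodule.sum_mem _ fun j hj =>
        Submodule.smul_mem _ _ (Submodule.subset_span ⟨j, hj, rfl⟩)
    · have := b.sum_repr (x - α)
      rw [← Finset.sum_compl_add_sum S] at this
      simp only [Basis.coord_apply]
      rw [add_assoc, this]
      abel

theorem isExtreme_face (h : IsVertexBasis P α b) : IsExtreme ℝ P (face P α b S) := by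
  refine ⟨fun x hx => hx.1, ?_⟩
  rintro x hx y hy z hz ⟨p, q, hp, hq, hpq, rfl⟩
  refine ⟨hx, fun j hj => ?_⟩
  have h1 := hz.2 j hj
  have h2 : p • x + q • y - α = p • (x - α) + q • (y - α) := by
    have : α = (p + q) • α := by rw [hpq, one_smul]
    conv_lhs => rw [this]
    module
  rw [h2, map_add, map_smul, map_smul, smul_eq_mul, smul_eq_mul] at h1
  have h3 := h.coord_nonneg hx j
  have h4 := h.coord_nonneg hy j
  nlinarith [mul_nonneg hp.le h3, mul_nonneg hq.le h4]

/-- A face through a second vertex is a coordinate face at this vertex. -/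
theorem face_eq_face [Fintype ι] (h : IsVertexBasis P α b) (h' : IsVertexBasis P β c)
    (hα : α ∈ face P β c S') : ∃ S, face P β c S' = face P α b S := by
  classical
  -- For `i ∉ S'` the functional `c.coord i (· - β)` is nonnegative on `P` and vanishes at `α`, so
  -- it cannot decrease along an edge at `α`.
  have hpos : ∀ i ∉ S', ∀ j, 0 ≤ c.coord i (b j) := by
    intro i hi j
    obtain ⟨ε, hε, hm⟩ := h.exists_edge j
    have h1 := h'.coord_nonneg hm i
    rw [add_sub_right_comm, map_add, hα.2 i hi, zero_add, map_smul, smul_eq_mul] at h1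
    exact nonneg_of_mul_nonneg_right h1 hε
  -- The edges at `α` along which all the defining functionals of the face stay zero.
  refine ⟨Finset.univ.filter fun j => ∀ i ∉ S', c.coord i (b j) = 0, ?_⟩
  ext x
  have key : ∀ i ∉ S', c.coord i (x - β) = ∑ j, b.coord j (x - α) * c.coord i (b j) := by
    intro i hi
    rw [← apply_eq_sum_coord, ← sub_add_sub_cancel x α β, map_add, hα.2 i hi, add_zero]
  refine and_congr_right fun hx => ⟨fun hm j hj => ?_, fun hm i hi => ?_⟩
  · simp only [Finset.mem_filter, Finset.mem_univ, true_and, not_forall] at hj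
    obtain ⟨i, hi, hne⟩ := hj
    have h1 := key i hi
    rw [hm i hi, eq_comm, Finset.sum_eq_zero_iff_of_nonneg
      fun j _ => mul_nonneg (h.coord_nonneg hx j) (hpos i hi j)] at h1
    exact (mul_eq_zero.1 (h1 j (Finset.mem_univ _))).resolve_right hne
  · rw [key i hi]
    refine Finset.sum_eq_zero fun j _ => ?_
    by_cases hj : ∀ i ∉ S', c.coord i (b j) = 0
    · rw [hj i hi, mul_zero]
    · rw [hm j (by simpa using hj), zero_mul]

end IsVertexBasis

/-- The maximizers of `ξ` on `F` form a nonempty compact exposed face, which has an extreme point;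
extremality is transitive up to `P`. -/
theorem exists_extremePoint_forall_le {F : Set V} (hF : IsCompact F) (hne : F.Nonempty)
    [FiniteDimensional ℝ V] (hP : IsExtreme ℝ P F) (ξ : Dual ℝ V) :
    ∃ α ∈ F, α ∈ P.extremePoints ℝ ∧ ∀ x ∈ F, ξ x ≤ ξ α := by
  set l : StrongDual ℝ V := ξ.toContinuousLinearMap
  have hexp : IsExposed ℝ F (l.toExposed F) := ContinuousLinearMap.toExposed.isExposed
  obtain ⟨m, hm, hmax⟩ := hF.exists_isMaxOn hne l.continuous.continuousOn
  have hne' : (l.toExposed F).Nonempty := ⟨m, hm, fun y hy => hmax hy⟩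
  obtain ⟨α, hα⟩ := (hexp.isCompact hF).extremePoints_nonempty hne'
  refine ⟨α, hα.1.1, ?_, fun x hx => hα.1.2 x hx⟩
  exact (hP.trans hexp.isExtreme).extremePoints_subset_extremePoints hα

/-- The directions at a vertex along which `ξ` increases. -/
def upSet [Fintype ι] (ξ : Dual ℝ V) (b : Basis ι ℝ V) : Finset ι :=
  open Classical in Finset.univ.filter fun j => 0 < ξ (b j)

theorem mem_upSet [Fintype ι] {ξ : Dual ℝ V} {j : ι} : j ∈ upSet ξ b ↔ 0 < ξ (b j) := by
  simp [upSet]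

/-- Strictness is what prevents a face from being listed at two different vertices. -/
theorem IsVertexBasis.apply_lt_of_mem_face [Fintype ι] (h : IsVertexBasis P α b) {ξ : Dual ℝ V}
    (hS : S ⊆ upSet ξ b) {x : V} (hx : x ∈ face P α b S) (hne : x ≠ α) : ξ α < ξ x := by
  have h1 := apply_eq_sum_coord b ξ (x - α)
  have hnn : ∀ j ∈ Finset.univ, 0 ≤ b.coord j (x - α) * ξ (b j) := by
    intro j _
    by_cases hj : j ∈ S
    · exact mul_nonneg (h.coord_nonneg hx.1 j) (mem_upSet.1 (hS hj)).le
    · rw [hx.2 j hj, zero_mul]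
  have h2 := Finset.sum_nonneg hnn
  rw [← h1, map_sub] at h2
  refine lt_of_le_of_ne (by linarith) fun heq => hne ?_
  rw [map_sub, heq, sub_self, eq_comm, Finset.sum_eq_zero_iff_of_nonneg hnn] at h1
  rw [← sub_eq_zero, ← b.forall_coord_eq_zero_iff]
  intro j
  by_cases hj : j ∈ S
  · exact (mul_eq_zero.1 (h1 j (Finset.mem_univ _))).resolve_right (mem_upSet.1 (hS hj)).ne'
  · exact hx.2 j hj

theorem isClosed_face [FiniteDimensional ℝ V] (hP : IsClosed P) : IsClosed (face P α b S) := by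
  have : face P α b S = P ∩ ⋂ j ∈ {j | j ∉ S}, {x | b.coord j (x - α) = 0} := by
    ext x
    simp [face]
  rw [this]
  refine hP.inter (isClosed_biInter fun j _ => isClosed_eq ?_ continuous_const)
  exact (b.coord j).continuous_of_finiteDimensional.comp (continuous_id.sub continuous_const)

/-- The terms of `S` and `insert i S` have opposite signs and cancel. -/
theorem sum_powerset_neg_one_pow_mul_eq_zero [DecidableEq ι] {U : Finset ι} {i : ι} (hi : i ∈ U)
    (g : Finset ι → ℂ) (hg : ∀ S, g (insert i S) = g S) :
    ∑ S ∈ U.powerset, (-1) ^ S.card * g S = 0 := by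
  rw [← Finset.insert_erase hi, Finset.sum_powerset_insert (Finset.notMem_erase i U),
    ← Finset.sum_add_distrib]
  refine Finset.sum_eq_zero fun S hS => ?_
  have hiS : i ∉ S := fun h => Finset.notMem_erase i U (Finset.mem_powerset.1 hS h)
  rw [Finset.card_insert_of_notMem hiS, hg S]
  ring

section Gram

variable [Fintype ι] {E : Finset V} {u : V → Basis ι ℝ V}

/-- The alternating sum of the tangent cones of the faces, each face being listed at its vertex
where `ξ` is smallest. -/
def gramSum (E : Finset V) (u : V → Basis ι ℝ V) (ξ : Dual ℝ V) (x : V) : ℂ :=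
  open Classical in
  ∑ α ∈ E, ∑ S ∈ (upSet ξ (u α)).powerset,
    (-1) ^ S.card * if ∀ j ∉ S, 0 ≤ (u α).coord j (x - α) then 1 else 0

/-- The collection of all faces. -/
def faces (P : Set V) (E : Finset V) (u : V → Basis ι ℝ V) : Set (Set V) :=
  {F | ∃ α ∈ E, ∃ S, F = face P α (u α) S}

/-- The right-hand side does not mention `ξ`, so the Gram sum may be computed with a form adapted to
the point `x`. The reason: each face has a unique lowest vertex for a generic form. -/
theorem gramSum_eq_finsum_faces [FiniteDimensional ℝ V] (hP : IsCompact P)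
    (hE : ∀ α, α ∈ E ↔ α ∈ P.extremePoints ℝ)
    (hu : ∀ α ∈ E, IsVertexBasis P α (u α)) {ξ : Dual ℝ V}
    (hξ : ∀ α ∈ E, ∀ j, ξ (u α j) ≠ 0) (x : V) :
    gramSum E u ξ x = ∑ᶠ F ∈ faces P E u,
      (-1) ^ finrank ℝ (vectorSpan ℝ F) *
        open Classical in if x ∈ faceCone P F then 1 else 0 := by
  classical
  rw [gramSum, Finset.sum_sigma']
  set I : Finset (Σ _ : V, Finset ι) := E.sigma fun α => (upSet ξ (u α)).powerset with hI
  have hmemI : ∀ p : Σ _ : V, Finset ι, p ∈ I ↔ p.1 ∈ E ∧ p.2 ⊆ upSet ξ (u p.1) := by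
    intro p
    simp [hI]
  have himage : faces P E u = (fun p : Σ _ : V, Finset ι => face P p.1 (u p.1) p.2) '' I := by
    ext F
    constructor
    · rintro ⟨β, hβ, S', rfl⟩
      have hv := hu β hβ
      obtain ⟨α, hαF, hαE, hmin⟩ := exists_extremePoint_forall_le
        (hP.of_isClosed_subset (isClosed_face hP.isClosed) fun x hx => hx.1) ⟨β, hv.mem_face⟩
        (hv.isExtreme_face (S := S')) (-ξ)
      rw [← hE] at hαE
      obtain ⟨S, hS⟩ := (hu α hαE).face_eq_face hv hαF
      refine ⟨⟨α, S⟩, (hmemI _).2 ⟨hαE, fun j hj => ?_⟩, hS.symm⟩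
      obtain ⟨ε, hε, hm⟩ := (hu α hαE).exists_edge j
      have h1 := hmin _ (hS ▸ (IsVertexBasis.edge_mem_face_iff hε hm).2 hj)
      simp only [LinearMap.neg_apply, map_add, map_smul, smul_eq_mul] at h1
      have h2 : 0 ≤ ξ (u α j) := nonneg_of_mul_nonneg_right (by linarith) hε
      exact mem_upSet.2 (lt_of_le_of_ne h2 (hξ α hαE j).symm)
    · rintro ⟨p, hp, rfl⟩
      exact ⟨p.1, ((hmemI p).1 hp).1, p.2, rfl⟩
  have hinj : Set.InjOn (fun p : Σ _ : V, Finset ι => face P p.1 (u p.1) p.2) I := by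
    rintro ⟨α, S⟩ hp ⟨β, S'⟩ hq heq
    obtain ⟨hα, hS⟩ := (hmemI _).1 hp
    obtain ⟨hβ, hS'⟩ := (hmemI _).1 hq
    simp only at heq hα hS hβ hS'
    have hαβ : α = β := by
      by_contra hne
      have h1 := (hu α hα).apply_lt_of_mem_face hS (heq ▸ (hu β hβ).mem_face) (Ne.symm hne)
      have h2 := (hu β hβ).apply_lt_of_mem_face hS' (heq ▸ (hu α hα).mem_face) hne
      exact lt_asymm h1 h2
    subst hαβ
    rw [(hu α hα).face_injective heq]
  rw [himage, finsum_mem_image hinj, finsum_mem_coe_finset]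
  refine Finset.sum_congr rfl fun p hp => ?_
  have hv := hu _ ((hmemI p).1 hp).1
  rw [hv.finrank_vectorSpan_face]
  simp only [hv.mem_faceCone_iff]

theorem gramSum_of_mem [FiniteDimensional ℝ V] (hP : IsCompact P)
    (hE : ∀ α, α ∈ E ↔ α ∈ P.extremePoints ℝ)
    (hu : ∀ α ∈ E, IsVertexBasis P α (u α)) {ξ : Dual ℝ V}
    (hξ : ∀ α ∈ E, ∀ j, ξ (u α j) ≠ 0) {x : V} (hx : x ∈ P) : gramSum E u ξ x = 1 := by
  classical
  obtain ⟨β, -, hβ, hmax⟩ := exists_extremePoint_forall_le hP ⟨x, hx⟩ (IsExtreme.refl ℝ P) ξ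
  rw [← hE] at hβ
  have hup : upSet ξ (u β) = ∅ := by
    refine Finset.eq_empty_of_forall_notMem fun j hj => ?_
    obtain ⟨ε, hε, hm⟩ := (hu β hβ).exists_edge j
    have h1 := hmax _ hm
    rw [map_add, map_smul, smul_eq_mul] at h1
    nlinarith [mem_upSet.1 hj, mul_pos hε (mem_upSet.1 hj)]
  -- At the top vertex `β` only `S = ∅` occurs and gives `1`. Any other vertex has an ascending
  -- edge, along which its terms cancel, since every indicator is `1` at a point of `P`.
  rw [gramSum, Finset.sum_eq_single_of_mem β hβ]
  · rw [hup]
    simpa using fun j => (hu β hβ).coord_nonneg hx j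
  · intro α hα hne
    obtain ⟨i, hi⟩ : (upSet ξ (u α)).Nonempty := by
      rw [Finset.nonempty_iff_ne_empty]
      intro hempty
      have h1 : ∀ j, j ∈ (Finset.univ : Finset ι) →
          (u α).coord j (β - α) * ξ (u α j) ≤ 0 := by
        intro j _
        have : ¬ 0 < ξ (u α j) := fun h => by
          have := mem_upSet.2 h
          simp [hempty] at this
        exact mul_nonpos_of_nonneg_of_nonpos ((hu α hα).coord_nonneg (hu β hβ).mem j)
          (not_lt.1 this)
      have h2 := apply_eq_sum_coord (u α) ξ (β - α)
      have h3 := hmax α (hu α hα).mem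
      have h4 := Finset.sum_nonpos h1
      have h5 : ∑ j, (u α).coord j (β - α) * ξ (u α j) = 0 := by
        apply le_antisymm h4
        rw [← h2, map_sub]
        linarith
      rw [Finset.sum_eq_zero_iff_of_nonpos h1] at h5
      refine hne ?_
      rw [eq_comm, ← sub_eq_zero, ← (u α).forall_coord_eq_zero_iff]
      exact fun j => (mul_eq_zero.1 (h5 j (Finset.mem_univ _))).resolve_right (hξ α hα j)
    refine sum_powerset_neg_one_pow_mul_eq_zero hi _ fun S => ?_
    rw [if_pos fun j _ => (hu α hα).coord_nonneg hx j, if_pos fun j _ =>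
      (hu α hα).coord_nonneg hx j]

/-- If some ascending coordinate of `x - α` is nonnegative, toggling it in `S` cancels the terms at
`α`. If all are negative, then a cone containing `x` would force `ξ x ≤ ξ α`, so every term is zero.
-/
theorem gramSum_of_forall_lt (hu : ∀ α ∈ E, IsVertexBasis P α (u α)) {ξ : Dual ℝ V} {x : V}
    (hx : ∀ p ∈ P, ξ p < ξ x) : gramSum E u ξ x = 0 := by
  classical
  refine Finset.sum_eq_zero fun α hα => ?_
  by_cases h1 : ∃ i ∈ upSet ξ (u α), 0 ≤ (u α).coord i (x - α)
  · obtain ⟨i, hi, hpos⟩ := h1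
    refine sum_powerset_neg_one_pow_mul_eq_zero hi _ fun S => ?_
    congr 1
    apply propext
    refine ⟨fun h j hj => ?_, fun h j hj => h j fun hjS => hj (Finset.mem_insert_of_mem hjS)⟩
    by_cases hji : j = i
    · exact hji ▸ hpos
    · exact h j (by simp [hji, hj])
  · push Not at h1
    refine Finset.sum_eq_zero fun S hS => ?_
    rw [if_neg, mul_zero]
    intro h2
    have h3 : ξ (x - α) ≤ 0 := by
      rw [apply_eq_sum_coord (u α)]
      refine Finset.sum_nonpos fun j _ => ?_
      by_cases hj : j ∈ upSet ξ (u α)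
      · exact mul_nonpos_of_nonpos_of_nonneg (h1 j hj).le (mem_upSet.1 hj).le
      · exact mul_nonpos_of_nonneg_of_nonpos
          (h2 j fun hjS => hj (Finset.mem_powerset.1 hS hjS))
          (not_lt.1 fun h => hj (mem_upSet.2 h))
    have h4 := hx α (hu α hα).mem
    rw [map_sub] at h3
    linarith

theorem exists_generic_dual (E : Finset V) (u : V → Basis ι ℝ V) :
    ∃ ξ : Dual ℝ V, ∀ α ∈ E, ∀ j, ξ (u α j) ≠ 0 := by
  obtain ⟨ξ, hξ⟩ := Module.exists_dual_forall_apply_ne_zero (K := ℝ)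
    (fun p : E × ι => u p.1 p.2) fun p => (u p.1).ne_zero p.2
  exact ⟨ξ, fun α hα j => hξ (⟨α, hα⟩, j)⟩

/-- A strictly separating form is perturbed by a small multiple of a generic one: compactness of `P`
preserves the separation, and each edge excludes no small positive multiple. -/
theorem exists_generic_separating [FiniteDimensional ℝ V] (hP : IsCompact P) (hconv : Convex ℝ P)
    {x : V} (hx : x ∉ P)
    (E : Finset V) (u : V → Basis ι ℝ V) :
    ∃ ξ : Dual ℝ V, (∀ α ∈ E, ∀ j, ξ (u α j) ≠ 0) ∧ ∀ p ∈ P, ξ p < ξ x := by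
  obtain ⟨η, hη⟩ := exists_generic_dual E u
  obtain ⟨f, a, hfa, hax⟩ := geometric_hahn_banach_closed_point hconv hP.isClosed hx
  obtain ⟨B, hB⟩ : ∃ B : ℝ, ∀ p ∈ P, η (p - x) ≤ B := by
    have hc : Continuous fun p => η (p - x) :=
      η.continuous_of_finiteDimensional.comp (continuous_id.sub continuous_const)
    obtain ⟨B, hB⟩ := (hP.image hc).bddAbove
    exact ⟨B, fun p hp => hB ⟨p, hp, rfl⟩⟩
  have hsmall : ∀ᶠ ε in nhdsWithin (0 : ℝ) (Set.Ioi 0), ε * B < f x - a := by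
    have : Filter.Tendsto (fun ε : ℝ => ε * B) (nhdsWithin 0 (Set.Ioi 0)) (nhds (0 * B)) :=
      ((continuous_id.mul continuous_const).tendsto _).mono_left nhdsWithin_le_nhds
    rw [zero_mul] at this
    exact this.eventually (gt_mem_nhds (by linarith))
  have hgen : ∀ᶠ ε in nhdsWithin (0 : ℝ) (Set.Ioi 0),
      ∀ p : E × ι, f (u p.1 p.2) + ε * η (u p.1 p.2) ≠ 0 := by
    rw [Filter.eventually_all]
    intro p
    have hne : η (u p.1 p.2) ≠ 0 := hη _ p.1.2 _
    by_cases h0 : f (u p.1 p.2) = 0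
    · filter_upwards [self_mem_nhdsWithin] with ε hε
      rw [h0, zero_add]
      exact mul_ne_zero (ne_of_gt hε) hne
    · have : Filter.Tendsto (fun ε : ℝ => f (u p.1 p.2) + ε * η (u p.1 p.2))
          (nhdsWithin 0 (Set.Ioi 0)) (nhds (f (u p.1 p.2) + 0 * η (u p.1 p.2))) :=
        ((continuous_const.add (continuous_id.mul continuous_const)).tendsto _).mono_left
          nhdsWithin_le_nhds
      exact this.eventually_ne (by simpa using h0)
  obtain ⟨ε, hε, h1, h2⟩ := ((eventually_mem_nhdsWithin).and (hsmall.and hgen)).exists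
  refine ⟨f.toLinearMap + ε • η, fun α hα j => h2 (⟨α, hα⟩, j), fun p hp => ?_⟩
  have h3 := hB p hp
  have h4 := hfa p hp
  have h5 : ε * η (p - x) ≤ ε * B := mul_le_mul_of_nonneg_left h3 (le_of_lt hε)
  rw [map_sub] at h5
  change f p + ε * η p < f x + ε * η x
  linarith

/-- The Brianchon–Gram formula for simple polytopes, with the faces listed by means of a generic
linear form. -/
theorem gramSum_eq_indicator [FiniteDimensional ℝ V] (hP : IsCompact P) (hconv : Convex ℝ P)
    (hE : ∀ α, α ∈ E ↔ α ∈ P.extremePoints ℝ)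
    (hu : ∀ α ∈ E, IsVertexBasis P α (u α)) {ξ : Dual ℝ V}
    (hξ : ∀ α ∈ E, ∀ j, ξ (u α j) ≠ 0) (x : V) :
    gramSum E u ξ x = open Classical in if x ∈ P then 1 else 0 := by
  split_ifs with hx
  · exact gramSum_of_mem hP hE hu hξ hx
  · obtain ⟨ξ', hξ', hlt⟩ := exists_generic_separating hP hconv hx E u
    rw [gramSum_eq_finsum_faces hP hE hu hξ, ← gramSum_eq_finsum_faces hP hE hu hξ',
      gramSum_of_forall_lt hu hlt]

end Gram

end BrianchonGram

/-! ### Extreme rays and primitive generators of simplicial cones -/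

section SimplicialCone

variable {W : Type*} [AddCommGroup W] [Module ℝ W] {ι : Type*}

theorem isExtreme_ray_iff (e : Basis ι ℝ W) {u : W} (hu : u ≠ 0) :
    IsExtreme ℝ {w | ∀ j, 0 ≤ e.coord j w} (ray u) ↔ ∃ j, ∃ r : ℝ, 0 < r ∧ u = r • e j := by
  classical
  constructor
  · intro h
    have hmem : u ∈ ray u := ⟨1, zero_le_one, by simp⟩
    have hpos := h.subset hmem
    obtain ⟨j, hj⟩ : ∃ j, e.coord j u ≠ 0 := by
      by_contra! hall
      exact hu (e.forall_coord_eq_zero_iff.1 hall)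
    have hj' : 0 < e.coord j u := lt_of_le_of_ne (hpos j) hj.symm
    -- `u` is the midpoint of twice its `j`-th component and twice the rest, both in the cone;
    -- extremality puts the former on the ray of `u`.
    have hx : (2 * e.coord j u) • e j ∈ {w | ∀ j, 0 ≤ e.coord j w} := by
      intro i
      by_cases hij : j = i
      · subst hij
        simpa using hj'.le
      · simp [hij]
    have hy : (2 : ℝ) • (u - e.coord j u • e j) ∈ {w | ∀ j, 0 ≤ e.coord j w} := by
      intro i
      by_cases hij : j = i
      · subst hij
        simp
      · simpa [hij] using hpos i
    have hseg : u ∈ openSegment ℝ ((2 * e.coord j u) • e j)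
        ((2 : ℝ) • (u - e.coord j u • e j)) :=
      ⟨1 / 2, 1 / 2, by norm_num, by norm_num, by norm_num, by module⟩
    obtain ⟨s, hs, hsu⟩ := h.left_mem_of_mem_openSegment hx hy hmem hseg
    have hs0 : s ≠ 0 := by
      rintro rfl
      rw [zero_smul, smul_eq_zero] at hsu
      exact hsu.elim (by positivity) (e.ne_zero j)
    refine ⟨j, s⁻¹ * (2 * e.coord j u), by positivity, ?_⟩
    rw [mul_smul, hsu, smul_smul, inv_mul_cancel₀ hs0, one_smul]
  · rintro ⟨j, r, hr, rfl⟩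
    refine ⟨?_, ?_⟩
    · rintro _ ⟨s, hs, rfl⟩ i
      by_cases hij : j = i
      · subst hij
        simpa using mul_nonneg hs hr.le
      · simp [hij]
    · rintro x hx y hy z ⟨s, hs, rfl⟩ ⟨p, q, hp, hq, -, hz⟩
      refine ⟨e.coord j x / r, div_nonneg (hx j) hr.le, ?_⟩
      rw [smul_smul, div_mul_cancel₀ _ hr.ne']
      apply e.ext_elem
      intro i
      by_cases hij : j = i
      · subst hij
        simp
      · have h1 := congrArg (e.coord i) hz
        have hx' := hx i
        have hy' := hy i
        simp only [map_add, map_smul, Basis.coord_apply, smul_eq_mul, Basis.repr_self,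
          Finsupp.single_apply, if_neg hij, mul_zero] at h1 hx' hy'
        simp only [map_smul, Basis.repr_self, Finsupp.smul_apply, Finsupp.single_apply, if_neg hij,
          smul_zero]
        nlinarith [mul_nonneg hp.le hx', mul_nonneg hq.le hy']

/-- Serves both for `σ_α` in `N`, where `c` is the first lattice multiple, and for `C_α` in `M'_α`,
where `c = 1`. -/
theorem primitiveGenerators_eq_range (L : Submodule ℤ W) (e : Basis ι ℝ W) (c : ι → ℝ)
    (hc : ∀ j, 0 < c j) (hmem : ∀ j, c j • e j ∈ L)
    (hmin : ∀ j, ∀ r : ℝ, 0 < r → r < c j → r • e j ∉ L) :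
    primitiveGenerators L {w | ∀ j, 0 ≤ e.coord j w} = Set.range fun j => c j • e j := by
  ext u
  constructor
  · rintro ⟨huL, hu0, hext, hprim⟩
    obtain ⟨j, r, hr, rfl⟩ := (isExtreme_ray_iff e hu0).1 hext
    refine ⟨j, ?_⟩
    rcases lt_trichotomy r (c j) with h | h | h
    · exact absurd huL (hmin j r hr h)
    · simp [h]
    · refine absurd (hmem j) ?_
      have := hprim (c j / r) (div_pos (hc j) hr) ((div_lt_one hr).2 h)
      rwa [smul_smul, div_mul_cancel₀ _ hr.ne'] at this
  · rintro ⟨j, rfl⟩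
    have h0 : c j • e j ≠ 0 := smul_ne_zero (hc j).ne' (e.ne_zero j)
    refine ⟨hmem j, h0, (isExtreme_ray_iff e h0).2 ⟨j, c j, hc j, rfl⟩, fun r hr hr1 => ?_⟩
    rw [smul_smul]
    exact hmin j _ (mul_pos hr (hc j)) (by nlinarith [hc j])

end SimplicialCone

/-! ### The dual lattice -/

section Lattice

variable {V : Type*} [NormedAddCommGroup V] [NormedSpace ℝ V]

theorem mem_latticeN {M : Submodule ℤ V} {f : Dual ℝ V} :
    f ∈ latticeN M ↔ ∀ w ∈ M, ∃ z : ℤ, f w = z := Iff.rfl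

theorem mem_span_int_range_iff {ι : Type*} [Fintype ι] (b : Basis ι ℝ V) {v : V} :
    v ∈ Submodule.span ℤ (Set.range b) ↔ ∀ i, ∃ z : ℤ, b.coord i v = z := by
  rw [b.mem_span_iff_repr_mem ℤ]
  simp only [Basis.coord_apply, Set.mem_range, eq_comm, algebraMap_int_eq, eq_intCast]

variable [FiniteDimensional ℝ V] (M : Submodule ℤ V) [DiscreteTopology M] [IsZLattice ℝ M]

/-- A basis of the lattice `M`, as a real basis. -/
theorem exists_basis_span_eq :
    ∃ b : Basis (Fin (finrank ℝ V)) ℝ V, Submodule.span ℤ (Set.range b) = M := by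
  have := ZLattice.module_free ℝ M
  have := ZLattice.module_finite ℝ M
  set b := (Module.finBasisOfFinrankEq ℤ M (ZLattice.rank ℝ M)).ofZLatticeBasis ℝ M
  exact ⟨b, Basis.ofZLatticeBasis_span ℝ M _⟩

variable {M}

/-- The coordinate forms of a lattice basis lie in `N`, and integral coordinates mean membership in
`M`. -/
theorem mem_of_forall_latticeN {v : V} (h : ∀ f ∈ latticeN M, ∃ z : ℤ, f v = z) : v ∈ M := by
  obtain ⟨b, hb⟩ := exists_basis_span_eq M
  rw [← hb, mem_span_int_range_iff]
  refine fun i => h _ fun w hw => ?_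
  rw [← hb, mem_span_int_range_iff] at hw
  exact hw i

variable (M)

theorem latticeN_module_finite : Module.Finite ℤ (latticeN M) := by
  obtain ⟨b, hb⟩ := exists_basis_span_eq M
  rw [Module.Finite.iff_fg]
  have : latticeN M = Submodule.span ℤ (Set.range b.dualBasis) := by
    ext f
    rw [b.dualBasis.mem_span_iff_repr_mem ℤ, mem_latticeN]
    simp only [Basis.dualBasis_repr, Set.mem_range, algebraMap_int_eq, eq_intCast]
    constructor
    · intro h i
      obtain ⟨z, hz⟩ := h (b i) (hb ▸ Submodule.subset_span ⟨i, rfl⟩)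
      exact ⟨z, hz.symm⟩
    · intro h w hw
      rw [← hb] at hw
      induction hw using Submodule.span_induction with
      | mem x hx =>
        obtain ⟨i, rfl⟩ := hx
        obtain ⟨z, hz⟩ := h i
        exact ⟨z, hz.symm⟩
      | zero => exact ⟨0, by simp⟩
      | add x y _ _ hx hy =>
        obtain ⟨p, hp⟩ := hx
        obtain ⟨q, hq⟩ := hy
        exact ⟨p + q, by simp [hp, hq]⟩
      | smul a x _ hx =>
        obtain ⟨p, hp⟩ := hx
        exact ⟨a * p, by simp [hp]⟩
  rw [this]
  exact Submodule.fg_span (Set.finite_range _)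

variable {M} {ι : Type*} [Fintype ι]

/-- The vectors `u j` span a sublattice of finite index in `M`; the index serves as `d`. -/
theorem exists_smul_coord_mem_latticeN (u : Basis ι ℝ V) (hu : ∀ j, u j ∈ M) :
    ∃ d : ℕ, 0 < d ∧ ∀ j, (d : ℝ) • u.coord j ∈ latticeN M := by
  have := ZLattice.module_free ℝ M
  have := ZLattice.module_finite ℝ M
  set L := Submodule.span ℤ (Set.range u)
  have hL : L ≤ M := Submodule.span_le.2 (by rintro _ ⟨j, rfl⟩; exact hu j)
  have hrank : finrank ℤ (L.submoduleOf M) = finrank ℤ M := by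
    rw [(Submodule.submoduleOfEquivOfLe hL).finrank_eq, ZLattice.rank ℝ M, ZLattice.rank ℝ L]
  have := Submodule.finiteQuotientOfFreeOfRankEq _ hrank
  refine ⟨Nat.card (M ⧸ L.submoduleOf M), Nat.card_pos, fun j w hw => ?_⟩
  have h1 := card_nsmul_eq_zero' (x := (Submodule.Quotient.mk ⟨w, hw⟩ : M ⧸ L.submoduleOf M))
  rw [← Submodule.Quotient.mk_smul, Submodule.Quotient.mk_eq_zero] at h1
  have h2 : Nat.card (M ⧸ L.submoduleOf M) • w ∈ L := h1
  rw [mem_span_int_range_iff] at h2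
  obtain ⟨z, hz⟩ := h2 j
  refine ⟨z, ?_⟩
  rw [← hz]
  simp

end Lattice

/-! ### Edge vectors as a basis of `M'_α` -/

section EdgeBasis

variable {V : Type*} [NormedAddCommGroup V] [NormedSpace ℝ V] {ι : Type*}
  {P : Set V} {α : V} {b : Basis ι ℝ V}

theorem coord_isUnitSMul (b : Basis ι ℝ V) {w : ι → ℝ} (hw : ∀ j, IsUnit (w j)) (j : ι) :
    (b.isUnitSMul hw).coord j = (w j)⁻¹ • b.coord j := by
  ext x
  simp [Basis.repr_isUnitSMul, Units.smul_def]

theorem IsVertexBasis.isUnitSMul (h : IsVertexBasis P α b) {w : ι → ℝ} (hw : ∀ j, IsUnit (w j))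
    (hpos : ∀ j, 0 < w j) : IsVertexBasis P α (b.isUnitSMul hw) := by
  refine ⟨h.mem_extremePoints, ?_⟩
  rw [h.tangentCone_eq]
  ext v
  refine forall_congr' fun j => ?_
  rw [coord_isUnitSMul, LinearMap.smul_apply, smul_eq_mul,
    mul_nonneg_iff_of_pos_left (inv_pos.2 (hpos j))]

theorem IsVertexBasis.dualCone_eq [Fintype ι] [DecidableEq ι] (h : IsVertexBasis P α b) :
    (dualCone P α : Set (Dual ℝ V)) = {f | ∀ j, 0 ≤ b.dualBasis.coord j f} := by
  ext f
  have : f ∈ (dualCone P α : Set (Dual ℝ V)) ↔ ∀ x ∈ tangentCone P α, 0 ≤ f x := Iff.rfl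
  rw [this, h.tangentCone_eq]
  simp only [Basis.coord_apply, Basis.dualBasis_repr, Set.mem_ofPred_eq]
  constructor
  · intro hf j
    refine hf _ fun i => ?_
    by_cases hij : j = i <;> simp [hij]
  · intro hf x hx
    rw [apply_eq_sum_coord b]
    exact Finset.sum_nonneg fun j _ => mul_nonneg (hx j) (hf j)

/-- The tangent cone of a full-dimensional set that is simple at `α` is generated by a basis. -/
theorem exists_isVertexBasis [FiniteDimensional ℝ V] (hfull : affineSpan ℝ P = ⊤)
    (hα : α ∈ P.extremePoints ℝ) (hs : IsSimpleAt P α) :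
    ∃ b : Basis (Fin (finrank ℝ V)) ℝ V, IsVertexBasis P α b := by
  obtain ⟨C, ⟨s, hfin, hli, rfl⟩, hC⟩ := hs
  have hspan : ⊤ ≤ Submodule.span ℝ (Set.range ((↑) : s → V)) := by
    rw [Subtype.range_coe, ← AffineSubspace.direction_top ℝ V V, ← hfull, direction_affineSpan,
      vectorSpan_eq_span_vsub_set_right ℝ hα.1, Submodule.span_le]
    rintro _ ⟨x, hx, rfl⟩
    have h1 : x - α ∈ (PointedCone.hull ℝ s : Set V) := by
      rw [hC]
      exact ⟨1, zero_le_one, x, hx, by simp⟩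
    exact Submodule.span_le_restrictScalars {c : ℝ // 0 ≤ c} ℝ s h1
  have := hfin.fintype
  have hli' : LinearIndependent ℝ ((↑) : s → V) := hli
  set b₀ : Basis s ℝ V := Basis.mk hli' hspan with hb₀
  have hcard : Fintype.card s = finrank ℝ V := (finrank_eq_card_basis b₀).symm
  set b := b₀.reindex (Fintype.equivFinOfCardEq hcard)
  have hb : Set.range b = s := by
    rw [Basis.range_reindex, hb₀, Basis.coe_mk, Subtype.range_coe]
  refine ⟨b, hα, ?_⟩
  rw [← hC, ← hb]
  ext w
  constructor
  · intro hw
    change w ∈ Submodule.span _ _ at hw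
    induction hw using Submodule.span_induction with
    | mem x hx =>
      obtain ⟨i, rfl⟩ := hx
      intro j
      by_cases hij : i = j <;> simp [hij]
    | zero => intro j; simp
    | add x y _ _ hx hy =>
      intro j
      rw [map_add]
      exact add_nonneg (hx j) (hy j)
    | smul a x _ hx =>
      intro j
      have : b.coord j (a • x) = (a : ℝ) * b.coord j x := map_smul (b.coord j) (a : ℝ) x
      rw [this]
      exact mul_nonneg a.2 (hx j)
  · intro hw
    change w ∈ Submodule.span _ _
    rw [← b.sum_repr w]
    refine Submodule.sum_mem _ fun j _ => ?_
    exact Submodule.smul_mem _ (⟨b.coord j w, hw j⟩ : {c : ℝ // 0 ≤ c})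
      (Submodule.subset_span ⟨j, rfl⟩)

/-- An edge of a compact set ends at a second vertex. -/
theorem IsVertexBasis.exists_opposite_vertex [Fintype ι] [FiniteDimensional ℝ V]
    (h : IsVertexBasis P α b) (hP : IsCompact P) (j : ι) :
    ∃ r : ℝ, 0 < r ∧ α + r • b j ∈ P.extremePoints ℝ := by
  classical
  -- Maximize the `j`-th coordinate over the edge, which is the face with `S = {j}`.
  obtain ⟨β, hβF, hβ, hmax⟩ := exists_extremePoint_forall_le
    (hP.of_isClosed_subset (isClosed_face hP.isClosed) fun x hx => hx.1) ⟨α, h.mem_face⟩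
    (h.isExtreme_face (S := {j})) (b.coord j)
  obtain ⟨ε, hε, hm⟩ := h.exists_edge j
  have h1 := hmax _ ((edge_mem_face_iff hε hm).2 (Finset.mem_singleton_self j))
  refine ⟨b.coord j (β - α), ?_, ?_⟩
  · simp only [map_add, map_smul, smul_eq_mul, map_sub, Basis.coord_apply, Basis.repr_self,
      Finsupp.single_eq_same, mul_one] at h1 ⊢
    linarith
  · have h2 : β - α = b.coord j (β - α) • b j := by
      conv_lhs => rw [← b.sum_repr (β - α)]
      refine Finset.sum_eq_single j (fun i _ hij => ?_) (by simp)
      have := hβF.2 i (by simpa using hij)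
      rw [Basis.coord_apply] at this
      rw [this, zero_smul]
    rw [← h2, add_sub_cancel]
    exact hβ

/-- The basis `b` consists of the edge vectors of `P` at `α`, which form a basis of the lattice
`M'_α`; its dual basis is a basis of the lattice `N'_α`. -/
structure IsEdgeBasis (M : Submodule ℤ V) (P : Set V) (α : V) (b : Basis ι ℝ V) : Prop where
  isVertexBasis : IsVertexBasis P α b
  exists_smul_mem : ∀ j, ∃ c : ℕ, 0 < c ∧ (c : ℝ) • b j ∈ M
  dualEdgeLattice_eq : dualEdgeLattice M P α = Submodule.span ℤ (Set.range b.coord)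

namespace IsEdgeBasis

variable {M : Submodule ℤ V}

theorem mem_superLattice_iff (h : IsEdgeBasis M P α b) {v : V} :
    v ∈ superLattice M P α ↔ ∀ j, ∃ z : ℤ, b.coord j v = z := by
  have : v ∈ superLattice M P α ↔ ∀ f ∈ dualEdgeLattice M P α, ∃ z : ℤ, f v = z := Iff.rfl
  rw [this, h.dualEdgeLattice_eq]
  refine ⟨fun hv j => hv _ (Submodule.subset_span ⟨j, rfl⟩), fun hv f hf => ?_⟩
  induction hf using Submodule.span_induction with
  | mem x hx =>
    obtain ⟨j, rfl⟩ := hx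
    exact hv j
  | zero => exact ⟨0, by simp⟩
  | add x y _ _ hx hy =>
    obtain ⟨p, hp⟩ := hx
    obtain ⟨q, hq⟩ := hy
    exact ⟨p + q, by simp [hp, hq]⟩
  | smul a x _ hx =>
    obtain ⟨p, hp⟩ := hx
    exact ⟨a * p, by simp [hp]⟩

theorem basis_mem_superLattice (h : IsEdgeBasis M P α b) (j : ι) : b j ∈ superLattice M P α := by
  classical
  rw [h.mem_superLattice_iff]
  intro i
  by_cases hij : j = i
  · exact ⟨1, by simp [hij]⟩
  · exact ⟨0, by simp [hij]⟩

/-- The edge vectors, as elements of `M'_α`. -/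
def edge (h : IsEdgeBasis M P α b) (j : ι) : superLattice M P α :=
  ⟨b j, h.basis_mem_superLattice j⟩

theorem edge_injective (h : IsEdgeBasis M P α b) : Function.Injective h.edge :=
  fun _ _ hij => b.injective (congrArg Subtype.val hij)

theorem edgeVectors_eq (h : IsEdgeBasis M P α b) : edgeVectors M P α = Set.range h.edge := by
  have h1 : primitiveGenerators (superLattice M P α) (tangentCone P α) = Set.range b := by
    rw [h.isVertexBasis.tangentCone_eq, primitiveGenerators_eq_range _ b (fun _ => 1)]
    · simp
    · simp
    · simpa using h.basis_mem_superLattice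
    · intro j r hr hr1 hmem
      obtain ⟨z, hz⟩ := h.mem_superLattice_iff.1 hmem j
      simp only [map_smul, Basis.coord_apply, Basis.repr_self, Finsupp.single_eq_same,
        smul_eq_mul, mul_one] at hz
      rw [hz] at hr hr1
      norm_cast at hr hr1
      omega
  ext l
  have : l ∈ edgeVectors M P α ↔
      (l : V) ∈ primitiveGenerators (superLattice M P α) (tangentCone P α) := Iff.rfl
  rw [this, h1]
  exact exists_congr fun j => (Subtype.ext_iff (a1 := h.edge j)).symm

end IsEdgeBasis

/-- The primitive generator of `σ_α` on the ray of `b.coord j` is its least positive integral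
multiple in `N`, say by `n j`. Dividing `b j` by `n j` makes these generators the dual basis. -/
theorem exists_isEdgeBasis [FiniteDimensional ℝ V] {M : Submodule ℤ V} [DiscreteTopology M]
    [IsZLattice ℝ M] [Fintype ι] (h : IsVertexBasis P α b) (hb : ∀ j, b j ∈ M) :
    ∃ c : Basis ι ℝ V, IsEdgeBasis M P α c := by
  classical
  obtain ⟨d, hd, hdN⟩ := exists_smul_coord_mem_latticeN b hb
  have hex : ∀ j, ∃ n : ℕ, 0 < n ∧ (n : ℝ) • b.coord j ∈ latticeN M := fun j => ⟨d, hd, hdN j⟩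
  set n : ι → ℕ := fun j => Nat.find (hex j)
  have hn : ∀ j, 0 < n j ∧ (n j : ℝ) • b.coord j ∈ latticeN M := fun j => Nat.find_spec (hex j)
  have hn0 : ∀ j, (0 : ℝ) < n j := fun j => by exact_mod_cast (hn j).1
  have hw : ∀ j, IsUnit ((n j : ℝ)⁻¹) := fun j => (inv_ne_zero (hn0 j).ne').isUnit
  have hcoord : ∀ j, (b.isUnitSMul hw).coord j = (n j : ℝ) • b.coord j := fun j => by
    rw [coord_isUnitSMul, inv_inv]
  refine ⟨b.isUnitSMul hw, h.isUnitSMul hw fun j => inv_pos.2 (hn0 j), fun j =>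
    ⟨n j, (hn j).1, ?_⟩, ?_⟩
  · rw [Basis.isUnitSMul_apply, smul_smul, mul_inv_cancel₀ (hn0 j).ne', one_smul]
    exact hb j
  · rw [dualEdgeLattice, h.dualCone_eq,
      primitiveGenerators_eq_range _ b.dualBasis (fun j => (n j : ℝ)) hn0]
    · congr 2
      ext1 j
      rw [hcoord, Basis.coe_dualBasis]
    · intro j
      rw [Basis.coe_dualBasis]
      exact (hn j).2
    · intro j r hr hrn hmem
      rw [Basis.coe_dualBasis] at hmem
      -- Evaluation at `b j ∈ M` shows that `r` is an integer, so minimality among natural multiples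
      -- suffices.
      obtain ⟨z, hz⟩ := hmem (b j) (hb j)
      have hz' : r = z := by simpa using hz
      lift z to ℕ using by
        rw [hz'] at hr
        exact_mod_cast hr.le
      have hz'' : r = z := by simpa using hz'
      rw [hz''] at hr hrn hmem
      exact Nat.find_min (hex j) (m := z) (show z < n j by exact_mod_cast hrn)
        ⟨by exact_mod_cast hr, hmem⟩

end EdgeBasis

/-! ### Characters of the lattices and of `K_α` -/

section Characters

variable {V : Type*} [NormedAddCommGroup V] [NormedSpace ℝ V]

theorem addChar_sum_zsmul {A ι : Type*} [AddCommGroup A] (ψ : AddChar A ℂ) (s : Finset ι)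
    (z : ι → ℤ) (x : ι → A) : ψ (∑ i ∈ s, z i • x i) = ∏ i ∈ s, ψ (x i) ^ z i := by
  classical
  induction s using Finset.induction_on with
  | empty => simp
  | insert a s ha ih =>
    rw [Finset.sum_insert ha, Finset.prod_insert ha, AddChar.map_add_eq_mul, ih,
      AddChar.map_zsmul_eq_zpow]

/-- The character `v ↦ exp(2πi ⟨f, v⟩)` of `V`. -/
def expChar (f : Dual ℝ V) : AddChar V ℂ where
  toFun v := Complex.exp (2 * Real.pi * Complex.I * ((f v : ℝ) : ℂ))
  map_zero_eq_one' := by simp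
  map_add_eq_mul' v w := by
    rw [map_add, Complex.ofReal_add, mul_add, Complex.exp_add]

theorem expChar_apply (f : Dual ℝ V) (v : V) :
    expChar f v = Complex.exp (2 * Real.pi * Complex.I * ((f v : ℝ) : ℂ)) := rfl

theorem expChar_eq_one_iff {f : Dual ℝ V} {v : V} : expChar f v = 1 ↔ ∃ z : ℤ, f v = z := by
  rw [expChar_apply, Complex.exp_eq_one_iff]
  refine exists_congr fun z => ?_
  have h : (2 * Real.pi * Complex.I : ℂ) ≠ 0 := Complex.two_pi_I_ne_zero
  rw [mul_comm (z : ℂ), mul_right_inj' h]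
  norm_cast

variable {M : Submodule ℤ V} {P : Set V} {α : V}

theorem eK_mk (n : latticeN M) (l : superLattice M P α) :
    eK M P α (Submodule.Quotient.mk n) l = expChar (n : Dual ℝ V) (l : V) := rfl

theorem eK_add_left (k k' : groupK M P α) (l : superLattice M P α) :
    eK M P α (k + k') l = eK M P α k l * eK M P α k' l := by
  obtain ⟨n, rfl⟩ := Submodule.Quotient.mk_surjective _ k
  obtain ⟨n', rfl⟩ := Submodule.Quotient.mk_surjective _ k'
  rw [← Submodule.Quotient.mk_add, eK_mk, eK_mk, eK_mk, expChar_apply, expChar_apply,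
    expChar_apply, ← Complex.exp_add]
  simp only [Submodule.coe_add, LinearMap.add_apply, Complex.ofReal_add, mul_add]

theorem eK_zero_left (l : superLattice M P α) : eK M P α 0 l = 1 := by
  rw [← Submodule.Quotient.mk_zero, eK_mk, expChar_apply]
  simp

/-- The character `k ↦ e_k(l)` of `K_α`. -/
def dualChar (l : superLattice M P α) : AddChar (groupK M P α) ℂ where
  toFun k := eK M P α k l
  map_zero_eq_one' := eK_zero_left l
  map_add_eq_mul' k k' := eK_add_left k k' l

/-- Orthogonality of characters: `k ↦ e_k(l)` is trivial exactly when `l` pairs integrally with `N`,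
that is, when `l ∈ M`. -/
theorem sum_eK [FiniteDimensional ℝ V] [DiscreteTopology M] [IsZLattice ℝ M]
    [Fintype (groupK M P α)] (l : superLattice M P α) :
    ∑ k, eK M P α k l =
      open Classical in if (l : V) ∈ M then (Nat.card (groupK M P α) : ℂ) else 0 := by
  split_ifs with hl
  · have : ∀ k, eK M P α k l = 1 := by
      intro k
      obtain ⟨n, rfl⟩ := Submodule.Quotient.mk_surjective _ k
      rw [eK_mk, expChar_eq_one_iff]
      exact n.2 _ hl
    simp [this]
  · refine AddChar.sum_eq_zero_of_ne_one (ψ := dualChar l) fun h => hl ?_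
    refine mem_of_forall_latticeN fun f hf => ?_
    rw [← expChar_eq_one_iff]
    exact DFunLike.congr_fun h (Submodule.Quotient.mk ⟨f, hf⟩)

/-- Every character of a lattice extends to the ambient vector space. -/
theorem exists_addChar_extension [FiniteDimensional ℝ V] [DiscreteTopology M] [IsZLattice ℝ M]
    (t : AddChar M ℂ) : ∃ T : AddChar V ℂ, ∀ m : M, T m = t m := by
  obtain ⟨b, hb⟩ := exists_basis_span_eq M
  have hbM : ∀ i, b i ∈ M := fun i => hb ▸ Submodule.subset_span ⟨i, rfl⟩
  -- Choose logarithms of `t` on a lattice basis and extend linearly in the real coordinates.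
  let T : AddChar V ℂ :=
    { toFun := fun v => Complex.exp (∑ i, (b.coord i v : ℂ) * Complex.log (t ⟨b i, hbM i⟩))
      map_zero_eq_one' := by simp
      map_add_eq_mul' := fun v w => by
        simp only [map_add, Complex.ofReal_add, add_mul, Finset.sum_add_distrib, Complex.exp_add] }
  have hT : ∀ i, T (b i) = t ⟨b i, hbM i⟩ := by
    intro i
    change Complex.exp _ = _
    rw [Finset.sum_eq_single i]
    · have : t ⟨b i, hbM i⟩ ≠ 0 := (t.val_isUnit _).ne_zero
      simp [Complex.exp_log this]
    · intro j _ hij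
      simp [hij.symm]
    · simp
  refine ⟨T, fun ⟨m, hm⟩ => ?_⟩
  have hm' := hm
  rw [← hb, mem_span_int_range_iff] at hm'
  choose z hz using hm'
  have h1 : m = ∑ i, z i • b i := by
    conv_lhs => rw [← b.sum_repr m]
    refine Finset.sum_congr rfl fun i _ => ?_
    rw [← Basis.coord_apply, hz, Int.cast_smul_eq_zsmul]
  have h2 : (⟨m, hm⟩ : M) = ∑ i, z i • (⟨b i, hbM i⟩ : M) := by
    apply Subtype.ext
    simp [h1]
  change T m = _
  rw [h2, addChar_sum_zsmul, h1, addChar_sum_zsmul]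
  simp only [hT]

/-- The restriction of a character of `V` to `M'_α`. -/
def restrictChar (M : Submodule ℤ V) (P : Set V) (α : V) (T : AddChar V ℂ) :
    AddChar (superLattice M P α) ℂ :=
  T.compAddMonoidHom (superLattice M P α).subtype.toAddMonoidHom

theorem restrictChar_apply (T : AddChar V ℂ) (l : superLattice M P α) :
    restrictChar M P α T l = T l := rfl

theorem liesOver_restrictChar {T : AddChar V ℂ} {t : AddChar M ℂ} (hT : ∀ m : M, T m = t m) :
    LiesOver M P α (restrictChar M P α T) t := fun m => hT m

namespace IsEdgeBasis

variable {ι : Type*} [Fintype ι] {b : Basis ι ℝ V}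

/-- `K_α` is finitely generated, and it is torsion because the product of the multipliers taking
each `b j` into `M` sends `N` into `N'_α`. -/
theorem finite_groupK [FiniteDimensional ℝ V] [DiscreteTopology M] [IsZLattice ℝ M]
    (h : IsEdgeBasis M P α b) : Finite (groupK M P α) := by
  classical
  have := latticeN_module_finite M
  refine Module.finite_of_fg_torsion _ fun k => ?_
  obtain ⟨n, rfl⟩ := Submodule.Quotient.mk_surjective _ k
  choose c hc hcM using h.exists_smul_mem
  have hprod : ((∏ j, c j : ℕ) : ℤ) ≠ 0 := by
    exact_mod_cast Finset.prod_ne_zero_iff.2 fun j _ => (hc j).ne'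
  refine ⟨⟨_, mem_nonZeroDivisors_of_ne_zero hprod⟩, ?_⟩
  rw [Submonoid.mk_smul, ← Submodule.Quotient.mk_smul, Submodule.Quotient.mk_eq_zero]
  change (((∏ j, c j : ℕ) : ℤ) • (n : Dual ℝ V)) ∈ dualEdgeLattice M P α
  rw [h.dualEdgeLattice_eq, ← Basis.coe_dualBasis, b.dualBasis.mem_span_iff_repr_mem ℤ]
  intro j
  obtain ⟨z, hz⟩ := n.2 _ (hcM j)
  refine ⟨(∏ i ∈ Finset.univ.erase j, c i : ℕ) * z, ?_⟩
  have hz' : (c j : ℝ) * (n : Dual ℝ V) (b j) = z := by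
    rw [← hz]
    simp
  rw [Basis.dualBasis_repr, ← Finset.mul_prod_erase _ _ (Finset.mem_univ j)]
  simp only [LinearMap.smul_apply, zsmul_eq_mul, algebraMap_int_eq, eq_intCast, Int.cast_mul,
    ← hz']
  push_cast
  ring

theorem addChar_ext (h : IsEdgeBasis M P α b) {ψ ψ' : AddChar (superLattice M P α) ℂ}
    (hψ : ∀ j, ψ (h.edge j) = ψ' (h.edge j)) : ψ = ψ' := by
  ext l
  choose z hz using h.mem_superLattice_iff.1 l.2
  have h1 : l = ∑ j, z j • h.edge j := by
    apply Subtype.ext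
    conv_lhs => rw [← b.sum_repr (l : V)]
    rw [AddSubmonoidClass.coe_finsetSum]
    refine Finset.sum_congr rfl fun i _ => ?_
    rw [← Basis.coord_apply, hz, Int.cast_smul_eq_zsmul]
    rfl
  rw [h1, addChar_sum_zsmul, addChar_sum_zsmul]
  simp only [hψ]

/-- Two points over the same point of the torus differ by a character `e_k`. -/
theorem exists_eq_eK_mul (h : IsEdgeBasis M P α b) {t : AddChar M ℂ}
    {t' t'' : AddChar (superLattice M P α) ℂ} (ht' : LiesOver M P α t' t)
    (ht'' : LiesOver M P α t'' t) : ∃ k, ∀ l, t'' l = eK M P α k l * t' l := by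
  classical
  have hne : ∀ l, t' l ≠ 0 := fun l => (t'.val_isUnit l).ne_zero
  -- A multiple of each edge vector lies in `M`, where both characters agree; so their ratio there
  -- is a root of unity.
  have hθ : ∀ j, ∃ θ : ℝ, t'' (h.edge j) =
      Complex.exp (2 * Real.pi * Complex.I * (θ : ℂ)) * t' (h.edge j) := by
    intro j
    obtain ⟨c, hc, hcM⟩ := h.exists_smul_mem j
    have h1 : c • h.edge j = Submodule.inclusion (le_superLattice M P α) ⟨(c : ℝ) • b j, hcM⟩ := by
      apply Subtype.ext
      simp [edge, Nat.cast_smul_eq_nsmul]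
    have h2 : (t'' (h.edge j) / t' (h.edge j)) ^ c = 1 := by
      rw [div_pow, ← AddChar.map_nsmul_eq_pow, ← AddChar.map_nsmul_eq_pow, h1, ht', ht'']
      exact div_self (t.val_isUnit _).ne_zero
    have h3 := Complex.norm_eq_one_of_pow_eq_one h2 hc.ne'
    refine ⟨Complex.arg (t'' (h.edge j) / t' (h.edge j)) / (2 * Real.pi), ?_⟩
    have h4 := Complex.norm_mul_exp_arg_mul_I (t'' (h.edge j) / t' (h.edge j))
    rw [h3, Complex.ofReal_one, one_mul] at h4
    rw [← div_eq_iff (hne _), ← h4]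
    congr 1
    rw [h4]
    have := Real.pi_ne_zero
    push_cast
    field_simp
  choose θ hθ using hθ
  set f : Dual ℝ V := ∑ j, θ j • b.coord j with hf
  have hfb : ∀ j, f (b j) = θ j := by
    intro j
    rw [hf, LinearMap.sum_apply, Finset.sum_eq_single j]
    · simp
    · intro i _ hij
      simp [hij.symm]
    · simp
  have hext : t'' = restrictChar M P α (expChar f) * t' := by
    refine h.addChar_ext fun j => ?_
    rw [AddChar.mul_apply, restrictChar_apply, expChar_apply, hθ j]
    change _ = Complex.exp (2 * Real.pi * Complex.I * ((f (b j) : ℝ) : ℂ)) * _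
    rw [hfb]
  -- The ratio of the two characters is trivial on `M`, which says that `f` is integral there.
  have hfN : f ∈ latticeN M := by
    intro m hm
    rw [Dual.eval_apply, ← expChar_eq_one_iff]
    have h1 := DFunLike.congr_fun hext (Submodule.inclusion (le_superLattice M P α) ⟨m, hm⟩)
    rw [AddChar.mul_apply, ht', ht'', restrictChar_apply] at h1
    exact mul_right_cancel₀ (t.val_isUnit _).ne_zero (h1.symm.trans (one_mul _).symm)
  exact ⟨Submodule.Quotient.mk ⟨f, hfN⟩, fun l => DFunLike.congr_fun hext l⟩

theorem isRegularAt_of_liesOver {α : M} {b : Basis ι ℝ V} (h : IsEdgeBasis M P α b)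
    {t : AddChar M ℂ} {t' t'' : AddChar (superLattice M P α) ℂ} (ht' : LiesOver M P α t' t)
    (ht'' : LiesOver M P α t'' t) (hreg : IsRegularAt M P α t') : IsRegularAt M P α t'' := by
  obtain ⟨k₀, hk₀⟩ := h.exists_eq_eK_mul ht' ht''
  intro k l hl
  rw [hk₀, ← mul_assoc, ← eK_add_left]
  exact hreg _ l hl

/-- Changing the extension shifts the summation index by a fixed element of `K_α`. -/
theorem nu_eq_of_liesOver {α : M} {b : Basis ι ℝ V} (h : IsEdgeBasis M P α b)
    {t : AddChar M ℂ} {t' t'' : AddChar (superLattice M P α) ℂ} (ht' : LiesOver M P α t' t)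
    (ht'' : LiesOver M P α t'' t) : nu M P α t t' = nu M P α t t'' := by
  obtain ⟨k₀, hk₀⟩ := h.exists_eq_eK_mul ht' ht''
  rw [nu, nu]
  congr 1
  rw [← finsum_comp_equiv (Equiv.addRight k₀)]
  simp only [hk₀, ← mul_assoc, ← eK_add_left, Equiv.coe_addRight]

end IsEdgeBasis

end Characters

/-! ### Formal sums over the lattice points of tangent cones -/

section VertexSum

variable {V : Type*} [NormedAddCommGroup V] [NormedSpace ℝ V] {M : Submodule ℤ V} {P : Set V}
  {α : V} {ι : Type*} {b : Basis ι ℝ V}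

namespace IsEdgeBasis

theorem sub_mem_superLattice_iff (h : IsEdgeBasis M P α b) (i : ι) {x : V} :
    x - b i ∈ superLattice M P α ↔ x ∈ superLattice M P α :=
  (superLattice M P α).sub_mem_iff_left (h.basis_mem_superLattice i)

theorem coord_sub_basis_of_ne {i j : ι} (hij : j ≠ i) (x : V) :
    b.coord j (x - b i) = b.coord j x := by
  simp [hij.symm]

theorem coord_sub_basis_self (i : ι) (x : V) : b.coord i (x - b i) = b.coord i x - 1 := by
  simp

/-- The formal sum of a character over the lattice points of a simplicial cone. -/
theorem hasFormalSum_cone (h : IsEdgeBasis M P α b) {T e : AddChar V ℂ}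
    (hreg : ∀ j, 1 - e (b j) * T (b j) ≠ 0) (A : Finset ι) :
    HasFormalSum T
      (fun x => open Classical in
        if x ∈ superLattice M P α ∧ ∀ j, 0 ≤ b.coord j x ∧ (j ∉ A → b.coord j x = 0)
          then e x else 0)
      (∏ j ∈ A, (1 - e (b j) * T (b j))⁻¹) := by
  classical
  induction A using Finset.induction_on with
  | empty =>
    have h1 : ∀ x, (x ∈ superLattice M P α ∧
        ∀ j, 0 ≤ b.coord j x ∧ (j ∉ (∅ : Finset ι) → b.coord j x = 0)) ↔ x = 0 := by
      intro x
      constructor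
      · rintro ⟨-, hx⟩
        exact b.forall_coord_eq_zero_iff.1 fun j => (hx j).2 (Finset.notMem_empty j)
      · rintro rfl
        exact ⟨Submodule.zero_mem _, fun j => by simp⟩
    simp only [h1]
    have := HasFormalSum.of_finset (T := T) (f := fun x => if x = 0 then e x else 0) (A := {0})
      (fun x hx => if_neg (by simpa using hx))
    simpa using this
  | insert i A hi ih =>
    rw [Finset.prod_insert hi, mul_comm, ← div_eq_mul_inv]
    -- Subtracting the translate by `b i` with weight `e (b i)` leaves only the layer where the
    -- `i`-th coordinate is zero: a geometric series in direction `i`.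
    refine HasFormalSum.of_sub_translate (hreg i) ?_
    convert ih using 1
    ext x
    rw [h.sub_mem_superLattice_iff]
    by_cases hx : x ∈ superLattice M P α
    swap
    · simp [hx]
    obtain ⟨z, hz⟩ := h.mem_superLattice_iff.1 hx i
    have he : e (b i) * e (x - b i) = e x := by
      rw [← AddChar.map_add_eq_mul, add_sub_cancel]
    have hsplit : ∀ (B : Finset ι) (y : V),
        (∀ j, 0 ≤ b.coord j y ∧ (j ∉ B → b.coord j y = 0)) ↔
        (0 ≤ b.coord i y ∧ (i ∉ B → b.coord i y = 0)) ∧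
          ∀ j, j ≠ i → 0 ≤ b.coord j y ∧ (j ∉ B → b.coord j y = 0) := by
      intro B y
      refine ⟨fun hy => ⟨hy i, fun j _ => hy j⟩, fun hy j => ?_⟩
      by_cases hj : j = i
      · exact hj ▸ hy.1
      · exact hy.2 j hj
    have hrest : ∀ y : V, (∀ j, j ≠ i → b.coord j y = b.coord j x) →
        ((∀ j, j ≠ i → 0 ≤ b.coord j y ∧ (j ∉ insert i A → b.coord j y = 0)) ↔
          ∀ j, j ≠ i → 0 ≤ b.coord j x ∧ (j ∉ A → b.coord j x = 0)) := by
      intro y hy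
      refine forall_congr' fun j => forall_congr' fun hj => ?_
      rw [hy j hj, Finset.mem_insert, or_iff_right hj]
    rw [hsplit _ x, hsplit _ (x - b i), hsplit A x, hrest x fun _ _ => rfl,
      hrest (x - b i) fun j hj => coord_sub_basis_of_ne hj x, coord_sub_basis_self, hz]
    generalize (∀ j, j ≠ i → 0 ≤ b.coord j x ∧ (j ∉ A → b.coord j x = 0)) = R
    by_cases hR : R
    swap
    · simp only [hR, and_false, if_false, mul_zero, sub_zero]
    have hz1 : (0 : ℝ) ≤ (z : ℝ) - 1 ↔ 1 ≤ z := by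
      rw [sub_nonneg]
      norm_cast
    have hz0 : (0 : ℝ) ≤ (z : ℝ) ↔ 0 ≤ z := by norm_cast
    have hze : (z : ℝ) = 0 ↔ z = 0 := by norm_cast
    simp only [hx, hR, Finset.mem_insert_self, not_true_eq_false, false_imp_iff, and_true,
      true_and, hi, not_false_eq_true, true_imp_iff, hz1, hz0, hze, mul_ite, he, mul_zero]
    rcases lt_trichotomy z 0 with hlt | rfl | hgt
    · rw [if_neg (not_le.2 hlt), if_neg (by omega : ¬ 1 ≤ z),
        if_neg fun h' => hlt.ne h'.2, sub_zero]
    · simp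
    · rw [if_pos hgt.le, if_pos (by omega : 1 ≤ z), if_neg fun h' => hgt.ne' h'.2, sub_self]

/-- The formal sum of a character over the lattice points of a cone that contains a line is zero. -/
theorem hasFormalSum_zero_of_mem (h : IsEdgeBasis M P α b) {T e : AddChar V ℂ} {S : Finset ι}
    {i : ι} (hi : i ∈ S) (hreg : 1 - e (b i) * T (b i) ≠ 0) :
    HasFormalSum T
      (fun x => open Classical in
        if x ∈ superLattice M P α ∧ ∀ j ∉ S, 0 ≤ b.coord j x then e x else 0) 0 := by
  classical
  set f : V → ℂ := fun x =>
    if x ∈ superLattice M P α ∧ ∀ j ∉ S, 0 ≤ b.coord j x then e x else 0 with hf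
  -- The `i`-th coordinate is unconstrained, so `f` equals its own weighted translate.
  suffices hs : HasFormalSum T (fun x => f x - e (b i) * f (x - b i)) 0 by
    simpa using hs.of_sub_translate hreg
  convert HasFormalSum.zero (T := T) using 1
  ext x
  simp only [hf]
  have h1 : (∀ j ∉ S, 0 ≤ b.coord j (x - b i)) ↔ ∀ j ∉ S, 0 ≤ b.coord j x := by
    refine forall_congr' fun j => forall_congr' fun hj => ?_
    rw [coord_sub_basis_of_ne fun hji : j = i => hj (hji ▸ hi)]
  rw [h.sub_mem_superLattice_iff, h1, mul_ite, ← AddChar.map_add_eq_mul, add_sub_cancel, mul_zero,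
    sub_self]
  rfl

variable [Fintype ι] [FiniteDimensional ℝ V] [DiscreteTopology M] [IsZLattice ℝ M]

/-- The formal sum over the lattice points of the tangent cone along a face at `α`. -/
theorem hasFormalSum_faceCone {α : M} (h : IsEdgeBasis M P α b) {T : AddChar V ℂ} {t : AddChar M ℂ}
    (hT : ∀ m : M, T m = t m) (hreg : IsRegularAt M P α (restrictChar M P α T)) (S : Finset ι) :
    HasFormalSum T
      (fun x => open Classical in
        if x ∈ M ∧ ∀ j ∉ S, 0 ≤ b.coord j (x - α) then 1 else 0)
      (open Classical in if S = ∅ then nu M P α t (restrictChar M P α T) else 0) := by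
  classical
  have := h.finite_groupK
  have := Fintype.ofFinite (groupK M P α)
  obtain ⟨rep, hrep⟩ := (Submodule.Quotient.mk_surjective
    ((dualEdgeLattice M P (α : V)).submoduleOf (latticeN M))).hasRightInverse
  have heK : ∀ k (l : superLattice M P α), eK M P α k l = expChar (rep k : Dual ℝ V) (l : V) := by
    intro k l
    rw [← eK_mk, hrep]
  have hreg' : ∀ k j, 1 - expChar (rep k : Dual ℝ V) (b j) * T (b j) ≠ 0 := by
    intro k j
    have := hreg k (h.edge j) (by rw [h.edgeVectors_eq]; exact ⟨j, rfl⟩)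
    rwa [heK] at this
  have hcard : (Nat.card (groupK M P α) : ℂ) ≠ 0 := by
    exact_mod_cast Nat.card_pos.ne'
  -- By `sum_eK` the indicator of `M` on `M'_α` is the average of the characters `e_k`; the apex is
  -- moved to the origin, which `α ∈ M` allows.
  have hfun : (fun x => if x ∈ M ∧ ∀ j ∉ S, 0 ≤ b.coord j (x - α) then (1 : ℂ) else 0) =
      fun x => (fun y => 1 / (Nat.card (groupK M P α) : ℂ) * ∑ k : groupK M P α,
        if y ∈ superLattice M P α ∧ ∀ j ∉ S, 0 ≤ b.coord j y
          then expChar (rep k : Dual ℝ V) y else 0) (x - α) := by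
    ext x
    have hxM : x - α ∈ M ↔ x ∈ M := M.sub_mem_iff_left α.2
    by_cases hpos : ∀ j ∉ S, 0 ≤ b.coord j (x - α)
    swap
    · simp only [hpos, and_false, if_false, Finset.sum_const_zero, mul_zero]
    have hM : (x ∈ M ∧ ∀ j ∉ S, 0 ≤ b.coord j (x - α)) ↔ x - α ∈ M := by
      rw [and_iff_left hpos, hxM]
    have hM' : (x - α ∈ superLattice M P α ∧ ∀ j ∉ S, 0 ≤ b.coord j (x - α)) ↔
        x - α ∈ superLattice M P α := and_iff_left hpos
    simp only [hM, hM']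
    by_cases hx : x - α ∈ superLattice M P α
    · have h1 := sum_eK (M := M) (P := P) (α := α) ⟨x - α, hx⟩
      simp only [heK] at h1
      simp only [hx, if_true, h1, mul_ite, mul_zero, one_div, inv_mul_cancel₀ hcard]
    · have : x - α ∉ M := fun hm => hx (le_superLattice M P α hm)
      simp only [hx, this, if_false, Finset.sum_const_zero, mul_zero]
  rw [hfun]
  have key : HasFormalSum T (fun y => 1 / (Nat.card (groupK M P α) : ℂ) * ∑ k : groupK M P α,
      if y ∈ superLattice M P α ∧ ∀ j ∉ S, 0 ≤ b.coord j y
        then expChar (rep k : Dual ℝ V) y else 0)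
      (1 / (Nat.card (groupK M P α) : ℂ) * ∑ k : groupK M P α,
        if S = ∅ then ∏ j, (1 - expChar (rep k : Dual ℝ V) (b j) * T (b j))⁻¹ else 0) := by
    refine HasFormalSum.const_mul (HasFormalSum.sum fun k _ => ?_) _
    split_ifs with hS
    · subst hS
      simpa using h.hasFormalSum_cone (hreg' k) Finset.univ
    · obtain ⟨i, hi⟩ := Finset.nonempty_iff_ne_empty.2 hS
      convert h.hasFormalSum_zero_of_mem hi (hreg' k i)
  convert key.translate (α : V) using 1
  split_ifs with hS
  · rw [nu, finsum_eq_sum_of_fintype, mul_left_comm]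
    congr 1
    rw [Finset.mul_sum]
    refine Finset.sum_congr rfl fun k _ => ?_
    rw [h.edgeVectors_eq, finprod_mem_range h.edge_injective, finprod_eq_prod_of_fintype, hT,
      div_eq_mul_inv, Finset.prod_inv_distrib]
    simp only [heK, restrictChar_apply]
    rfl
  · simp

end IsEdgeBasis

end VertexSum

/-! ### Comparison of the two formal sums -/

section Main

variable {V : Type*} [NormedAddCommGroup V] [NormedSpace ℝ V] {M : Submodule ℤ V} {P : Set V}

theorem IsConvexPolytope.convex (h : IsConvexPolytope P) : Convex ℝ P := by
  obtain ⟨-, H, rfl⟩ := h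
  intro x hx y hy p q hp hq hpq f hf
  have h1 := mul_le_mul_of_nonneg_left (hx f hf) hp
  have h2 := mul_le_mul_of_nonneg_left (hy f hf) hq
  have h3 : f.2 = p * f.2 + q * f.2 := by rw [← add_mul, hpq, one_mul]
  rw [map_add, map_smul, map_smul, smul_eq_mul, smul_eq_mul, h3]
  exact add_le_add h1 h2

variable [FiniteDimensional ℝ V]

theorem IsConvexPolytope.isCompact (h : IsConvexPolytope P) : IsCompact P := by
  have := FiniteDimensional.proper_real V
  refine Metric.isCompact_of_isClosed_isBounded ?_ h.1
  obtain ⟨-, H, rfl⟩ := h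
  have : {v : V | ∀ f ∈ H, f.1 v ≤ f.2} = ⋂ f ∈ H, {v | f.1 v ≤ f.2} := by
    ext v
    simp
  rw [this]
  exact isClosed_biInter fun f _ =>
    isClosed_le f.1.continuous_of_finiteDimensional continuous_const

variable [DiscreteTopology M] [IsZLattice ℝ M]

theorem finite_lattice_inter (hP : Bornology.IsBounded P) : {m : M | (m : V) ∈ P}.Finite := by
  obtain ⟨b, hb⟩ := exists_basis_span_eq M
  have := FiniteDimensional.proper_real V
  have h1 : (P ∩ M).Finite := by
    rw [← hb]
    exact ZSpan.setFinite_inter b hP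
  refine Set.Finite.of_finite_image (f := ((↑) : M → V)) (h1.subset ?_)
    Subtype.val_injective.injOn
  rintro _ ⟨m, hm, rfl⟩
  exact ⟨hm, m.2⟩

/-- Each edge joins two vertices in `M`, so its generator can be rescaled to their difference, a
vector of `M`. -/
theorem IsSimpleLatticePolytope.exists_isEdgeBasis (hP : IsSimpleLatticePolytope M P) {α : V}
    (hα : α ∈ P.extremePoints ℝ) :
    ∃ b : Basis (Fin (finrank ℝ V)) ℝ V, IsEdgeBasis M P α b := by
  obtain ⟨b, hb⟩ := exists_isVertexBasis hP.full_dim hα (hP.simple α hα)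
  choose r hr hrE using hb.exists_opposite_vertex hP.polytope.isCompact
  have hw : ∀ j, IsUnit (r j) := fun j => (hr j).ne'.isUnit
  refine LatticePolytope.exists_isEdgeBasis (hb.isUnitSMul hw hr) fun j => ?_
  rw [Basis.isUnitSMul_apply]
  have := M.sub_mem (hP.integral (hrE j)) (hP.integral hα)
  rwa [add_sub_cancel_left] at this

theorem IsSimpleLatticePolytope.finsum_eq (hP : IsSimpleLatticePolytope M P) {T : AddChar V ℂ}
    {t : AddChar M ℂ} (hT : ∀ m : M, T m = t m)
    (hreg : ∀ α ∈ vertices M P, IsRegularAt M P α (restrictChar M P α T)) :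
    ∑ᶠ m ∈ {m : M | (m : V) ∈ P}, t m =
      ∑ᶠ α ∈ vertices M P, nu M P α t (restrictChar M P α T) := by
  classical
  have hfin := finite_lattice_inter (M := M) hP.polytope.1
  have hvfin : (vertices M P).Finite := hfin.subset fun α hα => hα.1
  rw [finsum_mem_eq_finite_toFinset_sum _ hfin, finsum_mem_eq_finite_toFinset_sum _ hvfin]
  have : Nonempty (Basis (Fin (finrank ℝ V)) ℝ V) := ⟨finBasis ℝ V⟩
  choose! u hu using fun (α : V) (hα : α ∈ P.extremePoints ℝ) => hP.exists_isEdgeBasis hα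
  set E : Finset V := hvfin.toFinset.map (Function.Embedding.subtype _) with hEdef
  have hE : ∀ α, α ∈ E ↔ α ∈ P.extremePoints ℝ := by
    intro α
    simp only [hEdef, Finset.mem_map, Set.Finite.mem_toFinset, Function.Embedding.coe_subtype]
    exact ⟨by rintro ⟨a, ha, rfl⟩; exact ha, fun hα => ⟨⟨α, hP.integral hα⟩, hα, rfl⟩⟩
  obtain ⟨ξ, hξ⟩ := exists_generic_dual E u
  have hgram := gramSum_eq_indicator hP.polytope.isCompact hP.polytope.convex hE
    (fun α hα => (hu α ((hE α).1 hα)).isVertexBasis) hξ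
  set f : V → ℂ := fun x => if x ∈ M ∧ x ∈ P then 1 else 0 with hf
  have hleft : HasFormalSum T f (∑ m ∈ hfin.toFinset, t m) := by
    have h1 := HasFormalSum.of_finset (T := T) (f := f)
      (A := hfin.toFinset.map (Function.Embedding.subtype _)) ?_
    · convert h1 using 1
      rw [Finset.sum_map]
      refine Finset.sum_congr rfl fun m hm => ?_
      have hm' : (m : V) ∈ P := by simpa using hm
      simp [hf, hm', hT]
    · intro x hx
      refine if_neg fun hxP => hx ?_
      simp only [Finset.mem_map, Set.Finite.mem_toFinset, Function.Embedding.coe_subtype]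
      exact ⟨⟨x, hxP.1⟩, hxP.2, rfl⟩
  have hright : HasFormalSum T f
      (∑ α ∈ hvfin.toFinset, nu M P α t (restrictChar M P α T)) := by
    have h1 : f = fun x => ∑ α ∈ hvfin.toFinset, ∑ S ∈ (upSet ξ (u α)).powerset,
        (-1) ^ S.card * if x ∈ M ∧ ∀ j ∉ S, 0 ≤ (u α).coord j (x - α) then 1 else 0 := by
      ext x
      by_cases hx : x ∈ M
      · simp only [hf, hx, true_and, ← hgram x, gramSum, hEdef, Finset.sum_map,
          Function.Embedding.coe_subtype]
        refine Finset.sum_congr rfl fun α _ => Finset.sum_congr rfl fun S _ => ?_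
        congr 1
        split_ifs with hc
        · exact if_pos hc
        · exact if_neg hc
      · simp [hf, hx]
    have h2 : ∑ α ∈ hvfin.toFinset, nu M P α t (restrictChar M P α T) =
        ∑ α ∈ hvfin.toFinset, ∑ S ∈ (upSet ξ (u α)).powerset,
          (-1) ^ S.card * if S = ∅ then nu M P α t (restrictChar M P α T) else 0 := by
      refine Finset.sum_congr rfl fun α _ => ?_
      -- `S = ∅` is the vertex itself; it belongs to every powerset, so each vertex contributes
      -- once, with sign `+1`.
      rw [Finset.sum_eq_single_of_mem ∅ (Finset.empty_mem_powerset _)]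
      · simp
      · intro S _ hS
        simp [hS]
    rw [h1, h2]
    refine HasFormalSum.sum fun α hα => HasFormalSum.sum fun S _ => HasFormalSum.const_mul ?_ _
    have hα' : α ∈ vertices M P := by simpa using hα
    convert (hu α hα').hasFormalSum_faceCone hT (hreg α hα') S
  exact hleft.unique hright

end Main

end LatticePolytope

end

theorem mainTheorem1 {V : Type*} [NormedAddCommGroup V] [NormedSpace ℝ V] [FiniteDimensional ℝ V]
    (M : Submodule ℤ V) [DiscreteTopology M] [IsZLattice ℝ M]
    (P : Set V) (hP : LatticePolytope.IsSimpleLatticePolytope M P) :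
    -- all the sums and products below are finite, with `n` edge vectors at each vertex
    {m : M | (m : V) ∈ P}.Finite ∧ (LatticePolytope.vertices M P).Finite ∧
    (∀ α ∈ LatticePolytope.vertices M P,
      Finite (LatticePolytope.groupK M P α) ∧
      (LatticePolytope.edgeVectors M P α).Finite ∧
      (LatticePolytope.edgeVectors M P α).ncard = Module.finrank ℝ V ∧
      -- `ν_α` is a well-defined function of `t`
      (∀ t : AddChar M ℂ, ∃ t', LatticePolytope.LiesOver M P α t' t) ∧
      (∀ (t : AddChar M ℂ) (t' t'' : AddChar (LatticePolytope.superLattice M P α) ℂ),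
        LatticePolytope.LiesOver M P α t' t → LatticePolytope.LiesOver M P α t'' t →
        LatticePolytope.nu M P α t t' = LatticePolytope.nu M P α t t'')) ∧
    -- the formula, at every `t` where the right-hand side has no pole
    (∀ (t : AddChar M ℂ) (t' : ∀ α : M, AddChar (LatticePolytope.superLattice M P α) ℂ),
      (∀ α ∈ LatticePolytope.vertices M P,
        LatticePolytope.LiesOver M P α (t' α) t ∧ LatticePolytope.IsRegularAt M P α (t' α)) →
      ∑ᶠ m ∈ {m : M | (m : V) ∈ P}, t m =
        ∑ᶠ α ∈ LatticePolytope.vertices M P, LatticePolytope.nu M P α t (t' α)) := by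
  have hfin := LatticePolytope.finite_lattice_inter (M := M) hP.polytope.1
  refine ⟨hfin, hfin.subset fun α hα => hα.1, fun α hα => ?_, fun t t' ht' => ?_⟩
  · obtain ⟨b, hb⟩ := hP.exists_isEdgeBasis hα
    refine ⟨hb.finite_groupK, ?_, ?_, fun t => ?_, fun t t' t'' h' h'' =>
      hb.nu_eq_of_liesOver h' h''⟩
    · rw [hb.edgeVectors_eq]
      exact Set.finite_range _
    · rw [hb.edgeVectors_eq, Set.ncard_range_of_injective hb.edge_injective, Nat.card_fin]
    · obtain ⟨T, hT⟩ := LatticePolytope.exists_addChar_extension t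
      exact ⟨_, LatticePolytope.liesOver_restrictChar hT⟩
  -- A single character of `V` lies over `t` at all vertices at once; the given `t' α` are replaced
  -- by its restrictions, which changes neither `ν_α` nor regularity.
  · obtain ⟨T, hT⟩ := LatticePolytope.exists_addChar_extension t
    have hover : ∀ α : M, LatticePolytope.LiesOver M P α
        (LatticePolytope.restrictChar M P α T) t :=
      fun α => LatticePolytope.liesOver_restrictChar hT
    rw [hP.finsum_eq hT fun α hα => ?_]
    · refine finsum_mem_congr rfl fun α hα => ?_
      obtain ⟨b, hb⟩ := hP.exists_isEdgeBasis hα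
      exact hb.nu_eq_of_liesOver (hover α) (ht' α hα).1
    · obtain ⟨b, hb⟩ := hP.exists_isEdgeBasis hα
      exact hb.isRegularAt_of_liesOver (ht' α hα).1 (hover α) (ht' α hα).2
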